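/- Let $p$ be a prime, let $K$ be a finite extension of $\mathbb{Q}_p$ with absolute ramification index $e$, let $\overline K$ be an algebraic closure of $K$, and put $e^*:=\frac{ep}{p-1}$. Fix a uniformizer $\pi$ of $K$ and elements $\pi^{(n)}\in\overline K$ ($n\ge 0$) with $\pi^{(0)}=\pi$ and $(\pi^{(n+1)})^p=\pi^{(n)}$. Put $K_\infty:=\bigcup_n K(\pi^{(n)})$, $G_K:=\mathrm{Gal}(\overline K/K)$ and $G_{K_\infty}:=\mathrm{Gal}(\overline K/K_\infty)$. For real $v\geq -1$, let $G_K^{v}$ denote the ramification group of $G_K$ in Serre's upper numbering, i.e. the group of all $\sigma\in G_K$ such that $\sigma|_L\in \mathrm{Gal}(L/K)^{v}$ for every finite Galois extension $L/K$ inside $\overline K$, and write $I_K^{e^*}:=G_K^{e^*}$. Let $\mathbb{F}$ be a finite field of characteristic $p$, let $d\ge 0$, and let $\bar\rho:G_K\to \mathrm{GL}_d(\mathbb{F})$ be a continuous representation with $\bar\rho(I_K^{e^*})=\{1\}$. Then $\bar\rho(G_{K_\infty})=\bar\rho(G_K)$. In particular, among such representations, $\bar\rho$ is uniquely determined by its restriction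 to $G_{K_\infty}$: if $\bar\rho':G_K\to \mathrm{GL}_d(\mathbb{F})$ is another continuous representation with $\bar\rho'(I_K^{e^*})=\{1\}$, then $\bar\rho'|_{G_{K_\infty}}=\bar\rho|_{G_{K_\infty}}$ implies $\bar\rho'=\bar\rho$; more generally, every isomorphism $A\in\mathrm{GL}_d(\mathbb{F})$ from $\bar\rho|_{G_{K_\infty}}$ to $\bar\rho'|_{G_{K_\infty}}$ (that is, $\bar\rho'(g)=A\bar\rho(g)A^{-1}$ for all $g\in G_{K_\infty}$) is an isomorphism from $\bar\rho$ to $\bar\rho'$. -/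

import Mathlib

noncomputable section

namespace LocalRamification

/-! ### The valuation ring of an algebraic extension of `ℚ_[p]` -/

section Integers

variable (p : ℕ) [Fact p.Prime] (L : Type*) [Field L] [Algebra ℚ_[p] L]
  [Algebra.IsAlgebraic ℚ_[p] L]

/-- The valuation ring `𝓞_L` of an algebraic extension `L` of `ℚ_[p]`: the elements of absolute
value at most `1`, for the unique extension of the `p`-adic absolute value to `L`. -/
def integers : ValuationSubring L where
  carrier := {x | spectralNorm ℚ_[p] L x ≤ 1}
  mul_mem' {a b} ha hb := by
    have h := map_mul (spectralMulAlgNorm ℚ_[p] L) a b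
    simp only [spectralMulAlgNorm_def] at h
    simp only [Set.mem_ofPred_eq] at ha hb ⊢
    rw [h]
    exact mul_le_one₀ ha (spectralNorm_nonneg b) hb
  one_mem' := by simp [spectralNorm_one]
  add_mem' {a b} ha hb :=
    (isNonarchimedean_spectralNorm (K := ℚ_[p]) (L := L) a b).trans (max_le ha hb)
  zero_mem' := by simp [spectralNorm_zero]
  neg_mem' {a} ha := by
    simp only [Set.mem_ofPred_eq] at ha ⊢
    rwa [spectralNorm_neg (Algebra.IsAlgebraic.isAlgebraic a)]
  mem_or_inv_mem' a := by
    by_contra! h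
    simp only [Set.mem_ofPred_eq, not_le] at h
    have ha : a ≠ 0 := by
      rintro rfl
      have := h.1
      rw [spectralNorm_zero] at this
      linarith
    have h1 := map_mul (spectralMulAlgNorm ℚ_[p] L) a a⁻¹
    simp only [spectralMulAlgNorm_def, mul_inv_cancel₀ ha, spectralNorm_one] at h1
    have := one_lt_mul_of_lt_of_le h.1 h.2.le
    linarith

/-- The maximal ideal of the valuation ring of `L`. -/
abbrev maxIdeal : Ideal (integers p L) := IsLocalRing.maximalIdeal (integers p L)

/-- The absolute ramification index of `L`: the largest `n` such that `p ∈ 𝔪_L ^ n`. -/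
def absRamificationIdx : ℕ := sSup {n : ℕ | (p : integers p L) ∈ maxIdeal p L ^ n}

end Integers

/-! ### Ramification groups of a finite extension `L / K` -/

section Finite

variable (p : ℕ) [Fact p.Prime] (K L : Type*) [Field K] [Field L] [Algebra ℚ_[p] K]
  [Algebra ℚ_[p] L] [Algebra K L] [IsScalarTower ℚ_[p] K L] [Algebra.IsAlgebraic ℚ_[p] L]

/-- The natural action of `Gal(L/K)` on the valuation ring of `L`. -/
instance galAction : MulAction Gal(L/K) (integers p L) where
  smul σ x := ⟨σ x, by
    have h := spectralNorm_eq_of_equiv (K := ℚ_[p]) (σ.restrictScalars ℚ_[p]) (x : L)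
    exact h.symm.trans_le x.2⟩
  one_smul _ := rfl
  mul_smul _ _ _ := rfl

/-- The ramification group `G_u` of `G = Gal(L/K)` in the lower numbering, for real `u ≥ -1`:
with `i` the least integer `≥ u`, the `σ` that act trivially on `𝓞_L / 𝔪_L ^ (i + 1)`. -/
def lowerGroup (u : ℝ) : Subgroup Gal(L/K) :=
  (maxIdeal p L ^ ⌈u + 1⌉₊).toAddSubgroup.inertia Gal(L/K)

/-- The Herbrand function `φ_{L/K}(u) = ∫₀ᵘ dt / (G_0 : G_t)`. -/
def herbrand (u : ℝ) : ℝ :=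
  ∫ t in (0 : ℝ)..u, (((lowerGroup p K L t).relIndex (lowerGroup p K L 0) : ℕ) : ℝ)⁻¹

/-- The function `ψ_{L/K}`, inverse to the bijection `φ_{L/K} : [-1, ∞) → [-1, ∞)`. -/
def herbrandInv (v : ℝ) : ℝ := Function.invFunOn (herbrand p K L) (Set.Ici (-1)) v

/-- The ramification group `G^v = G_{ψ(v)}` of `G = Gal(L/K)` in the upper numbering, for
`v ≥ -1`. -/
def upperGroup (v : ℝ) : Subgroup Gal(L/K) := lowerGroup p K L (herbrandInv p K L v)

end Finite

/-! ### Ramification groups of the absolute Galois group -/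

section Absolute

variable (p : ℕ) [Fact p.Prime] (K : Type*) [Field K] [Algebra ℚ_[p] K]
  [FiniteDimensional ℚ_[p] K]

instance isAlgebraic_of_finiteGalois
    (L : FiniteGaloisIntermediateField K (AlgebraicClosure K)) : Algebra.IsAlgebraic ℚ_[p] L :=
  Algebra.IsAlgebraic.trans ℚ_[p] K L

/-- The ramification group of the absolute Galois group of `K` in the upper numbering: the
automorphisms whose restriction to every finite Galois extension `L / K` lies in
`Gal(L/K)^v`. -/
def absUpperGroup (v : ℝ) : Subgroup Gal(AlgebraicClosure K/K) :=
  ⨅ L : FiniteGaloisIntermediateField K (AlgebraicClosure K),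
    (upperGroup p K L v).comap (AlgEquiv.restrictNormalHom L)

/-- The number `e* = e p / (p - 1)`, where `e` is the absolute ramification index of `K`. -/
def eStar : ℝ := (absRamificationIdx p K : ℝ) * p / ((p : ℝ) - 1)

end Absolute

end LocalRamification

end

/-!
Write `‖·‖` for the absolute value of the algebraic extensions of `ℚ_[p]` and `e* = e p / (p - 1)`.
All three claims follow from the decomposition `G_K = G_K^{e*} · G_{K_∞}`
(`LocalRamification.exists_mul_eq_of_fixingSubgroup`): a representation that is trivial on the first
factor is determined by its values on the second. In turn, the decomposition says that every
`σ ∈ G_K` agrees on all the roots `ϖ n` with an element of `G_K^{e*}`. By compactness of `G_K` this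
reduces to two statements about a finite Galois extension `F / K`: the group `Gal(F/K)^{e*}` acts
transitively on the `p ^ n`-th roots of `π` in `F`, if there are any
(`LocalRamification.exists_mem_upperGroup_apply_eq`), and restriction to a smaller Galois extension
respects the upper numbering (`LocalRamification.restrictNormalHom_mem_upperGroup`).

Both rest on a multiplicative description of the upper numbering. Let `ϖ` be a uniformizer of `F`,
`G₀` the inertia group, and `d σ = ‖σ ϖ - ϖ‖`, an ultrametric length function on `G₀`. For `v > 0`,
an element `σ ∈ G₀` lies in `Gal(F/K)^v` if and only if
`∏ g ∈ G₀, max (d g) (d σ) ≤ ‖π‖ ^ (v + 1)` (`LocalRamification.mem_upperGroup_iff`).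
No normalizations occur in this form, since `‖π‖ = ‖ϖ‖ ^ |G₀|`.

Let `S ≤ G₀` and let `c` be a uniformizer of the fixed field of `S`. Evaluating at `ϖ` the
difference between `∏ τ ∈ S, (X - τ ϖ)` and its image under `σ` bounds the product of `d` over the
coset `σ S` from above by `‖σ c - c‖`, and from below by the same quantity if `S` is normal
(`LocalRamification.prod_displacement_le`, `LocalRamification.le_prod_displacement`). On choosing
coset representatives of minimal length, the two bounds compare the product over `G₀` with products
over `G₀ ⧸ S`. If `S` is the kernel of the restriction to a Galois subextension, this gives the
compatibility with quotients. If `S` is the stabilizer of a root `r` of `X ^ (p ^ n) - π`, then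
`r` is a uniformizer of the fixed field of `S`, there are `p ^ n` cosets, and each factor is at most
`‖ζ - 1‖ * ‖r‖` for a root of unity `ζ` of `p`-power order dividing `p ^ n`. As
`‖ζ - 1‖ ^ (p ^ n) ≤ ‖p‖ ^ (p / (p - 1)) = ‖π‖ ^ e*`, the product is at most `‖π‖ ^ (e* + 1)`.
-/

/-! ### Products of length functions over cosets -/

section Cosets

variable {G : Type*} [Group G] [Fintype G] (S : Subgroup G) [Fintype S] [Fintype (G ⧸ S)]

theorem prod_eq_prod_quotient_prod_subgroup {M : Type*} [CommMonoid M] (r : G ⧸ S → G)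
    (hr : ∀ q, (r q : G ⧸ S) = q) (f : G → M) :
    ∏ g, f g = ∏ q, ∏ τ : S, f (r q * τ) := by
  rw [← Fintype.prod_prod_type' (f := fun q (τ : S) ↦ f (r q * τ))]
  symm
  refine Fintype.prod_bijective (fun x : (G ⧸ S) × S ↦ r x.1 * x.2) ⟨?_, fun g ↦ ?_⟩ _ _
    fun _ ↦ rfl
  · rintro ⟨q, τ⟩ ⟨q', τ'⟩ h
    have hq : q = q' := by
      have := congrArg (QuotientGroup.mk (s := S)) h
      simpa [QuotientGroup.mk_mul_of_mem, hr] using this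
    subst hq
    simpa using h
  · exact ⟨(g, ⟨(r g)⁻¹ * g, QuotientGroup.eq.mp (hr g)⟩), by simp⟩

omit [Fintype S] [Fintype (G ⧸ S)] in
/-- Every coset of `S` has a representative at which `d` is least. -/
theorem exists_min_representative (d : G → ℝ) :
    ∃ r : G ⧸ S → G, (∀ q, (r q : G ⧸ S) = q) ∧ ∀ q, ∀ τ ∈ S, d (r q) ≤ d (r q * τ) := by
  have (q : G ⧸ S) : ∃ g : G, (g : G ⧸ S) = q ∧ ∀ τ ∈ S, d g ≤ d (g * τ) := by
    obtain ⟨g, hg, hmin⟩ := Set.exists_min_image {g : G | (g : G ⧸ S) = q} d (Set.toFinite _)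
      ⟨q.out, Quotient.out_eq' q⟩
    refine ⟨g, hg, fun τ hτ ↦ hmin _ ?_⟩
    change ((g * τ : G) : G ⧸ S) = q
    rw [QuotientGroup.mk_mul_of_mem _ hτ]
    exact hg
  choose r hr using this
  exact ⟨r, fun q ↦ (hr q).1, fun q ↦ (hr q).2⟩

variable {S} {d D : G → ℝ} (d_nonneg : ∀ g, 0 ≤ d g) (d_mul : ∀ g h, d (g * h) ≤ max (d g) (d h))
  (d_inv : ∀ g, d g⁻¹ = d g) (D_mul : ∀ g, ∀ τ ∈ S, D (g * τ) = D g)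

include d_mul d_inv in
omit [Fintype G] [Fintype S] [Fintype (G ⧸ S)] in
/-- If `g` minimizes the length on the coset `g S`, then `d (g τ) = max (d g) (d τ)`; this is the
half of the equality that is not part of the hypotheses. -/
theorem le_of_min_representative {g : G} (hg : ∀ τ ∈ S, d g ≤ d (g * τ)) {τ : G} (hτ : τ ∈ S) :
    d τ ≤ d (g * τ) := by
  have := d_mul g⁻¹ (g * τ)
  rw [inv_mul_cancel_left, d_inv, max_eq_right (hg τ hτ)] at this
  exact this

include d_nonneg d_mul d_inv D_mul in
/-- If `D` is bounded on each coset of `S` by the product of `d` over that coset, then the product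
`∏ max (D q) (D σ)` over the cosets is at most `∏ max (d g) (d σ)` over `G`. -/
theorem prod_quotient_max_le_prod_max (hD : ∀ g, D g ≤ ∏ τ : S, d (g * τ))
    (D_nonneg : ∀ g, 0 ≤ D g) (σ : G) (r : G ⧸ S → G) (hr : ∀ q, (r q : G ⧸ S) = q) :
    ∏ q, max (D (r q)) (D σ) ≤ ∏ g, max (d g) (d σ) := by
  obtain ⟨r', hr', hmin⟩ := exists_min_representative S d
  have hrr (q : G ⧸ S) : D (r q) = D (r' q) := by
    have h : (r' q)⁻¹ * r q ∈ S := QuotientGroup.eq.mp ((hr' q).trans (hr q).symm)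
    rw [← D_mul (r' q) _ h, mul_inv_cancel_left]
  rw [prod_eq_prod_quotient_prod_subgroup S r' hr']
  refine Finset.prod_le_prod (fun q _ ↦ le_max_of_le_right (D_nonneg σ)) fun q _ ↦ max_le ?_ ?_
  · rw [hrr]
    exact (hD _).trans (Finset.prod_le_prod (fun _ _ ↦ d_nonneg _) fun _ _ ↦ le_max_left _ _)
  · refine (hD σ).trans (Finset.prod_le_prod (fun _ _ ↦ d_nonneg _) fun τ _ ↦ ?_)
    refine (d_mul σ τ).trans (max_le (le_max_right _ _) (le_max_of_le_left ?_))
    exact le_of_min_representative d_mul d_inv (hmin q) τ.2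

include d_nonneg d_mul d_inv D_mul in
/-- If `D` bounds on each coset of `S` the product of `d` over that coset, then
`∏ max (d g) (d σ)` over `G` is at most `∏ max (D q) (D σ)` over the cosets, for every `σ` which
minimizes `d` on its coset. -/
theorem prod_max_le_prod_quotient_max (hD : ∀ g, ∏ τ : S, d (g * τ) ≤ D g)
    {σ : G} (hσ : ∀ τ ∈ S, d σ ≤ d (σ * τ)) (r : G ⧸ S → G) (hr : ∀ q, (r q : G ⧸ S) = q) :
    ∏ g, max (d g) (d σ) ≤ ∏ q, max (D (r q)) (D σ) := by
  obtain ⟨r', hr', hmin⟩ := exists_min_representative S d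
  have hrr (q : G ⧸ S) : D (r q) = D (r' q) := by
    have h : (r' q)⁻¹ * r q ∈ S := QuotientGroup.eq.mp ((hr' q).trans (hr q).symm)
    rw [← D_mul (r' q) _ h, mul_inv_cancel_left]
  rw [prod_eq_prod_quotient_prod_subgroup S r' hr']
  have h0 (g h : G) : 0 ≤ max (d g) (d h) := le_max_of_le_left (d_nonneg g)
  refine Finset.prod_le_prod (fun q _ ↦ Finset.prod_nonneg fun _ _ ↦ h0 _ _) fun q _ ↦ ?_
  rcases le_total (d σ) (d (r' q)) with h | h
  · refine le_max_of_le_left (le_of_le_of_eq (le_trans ?_ (hD (r' q))) (hrr q).symm)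
    refine Finset.prod_le_prod (fun _ _ ↦ h0 _ _) fun τ _ ↦ max_le le_rfl ?_
    exact h.trans (hmin q τ τ.2)
  · refine le_max_of_le_right (le_trans ?_ (hD σ))
    refine Finset.prod_le_prod (fun _ _ ↦ h0 _ _) fun τ _ ↦ max_le ?_ (hσ τ τ.2)
    exact (d_mul _ _).trans
      (max_le (h.trans (hσ τ τ.2)) (le_of_min_representative d_mul d_inv hσ τ.2))

end Cosets

/-! ### Displacement of elements by isometric automorphisms -/

section Displacement

open Polynomial

variable {F : Type*} [NormedField F] [IsUltrametricDist F]

theorem norm_sub_le_max' (x y : F) : ‖x - y‖ ≤ max ‖x‖ ‖y‖ := by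
  rw [sub_eq_add_neg, ← norm_neg y]
  exact IsUltrametricDist.norm_add_le_max x (-y)

theorem exists_pow_prime_sub_pow_eq {p : ℕ} (hp : p.Prime) {x y : F} (hx : ‖x‖ ≤ 1)
    (hy : ‖y‖ ≤ 1) : ∃ r : F, ‖r‖ ≤ 1 ∧ (y + x) ^ p - y ^ p = x ^ p + p * y * x * r := by
  let O := (NormedField.valuation (K := F)).integer
  obtain ⟨r, hr⟩ := exists_add_pow_prime_eq hp (⟨y, hy⟩ : O) ⟨x, hx⟩
  refine ⟨r, r.2, ?_⟩
  have := congrArg (Subtype.val) hr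
  push_cast at this
  rw [this]
  ring

theorem norm_pow_prime_sub_pow_le {p : ℕ} (hp : p.Prime) {x y : F} (hx : ‖x‖ ≤ 1)
    (hy : ‖y‖ ≤ 1) : ‖x ^ p - y ^ p‖ ≤ max ‖(p : F)‖ ‖x - y‖ * ‖x - y‖ := by
  have hxy : ‖x - y‖ ≤ 1 := (norm_sub_le_max' x y).trans (max_le hx hy)
  obtain ⟨r, hr, h⟩ := exists_pow_prime_sub_pow_eq hp hxy hy
  rw [add_sub_cancel] at h
  rw [h]
  refine (IsUltrametricDist.norm_add_le_max _ _).trans (max_le ?_ ?_)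
  · rw [norm_pow]
    refine (pow_le_pow_of_le_one (norm_nonneg _) hxy hp.two_le).trans ?_
    rw [sq]
    gcongr
    exact le_max_right _ _
  · rw [norm_mul, norm_mul, norm_mul]
    calc ‖(p : F)‖ * ‖y‖ * ‖x - y‖ * ‖r‖ ≤ ‖(p : F)‖ * 1 * ‖x - y‖ * 1 := by gcongr
      _ ≤ _ := by
        rw [mul_one, mul_one]
        gcongr
        exact le_max_left _ _

/-- Let `A` be a set of integral elements, each of which is a `p`-th power modulo `ϖ`. An isometry
`σ` that is congruent to the identity on `A` moves no element of `A` further than `ϖ`.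
If `σ` moves `A` by at most `δ < 1`, it moves `p`-th powers by less than `δ`, and
hence the bound on `A` improves until it reaches the displacement of `ϖ`. -/
theorem norm_map_sub_le_of_forall_exists_pow {p : ℕ} (hp : p.Prime) (hpF : ‖(p : F)‖ < 1)
    (σ : F →+* F) (hσ : ∀ x, ‖σ x‖ = ‖x‖) {A : Set F} (hA : ∀ x ∈ A, ‖x‖ ≤ 1)
    {ϖ : F} (hϖ : ‖ϖ‖ < 1) (hAϖ : ∀ x ∈ A, ∃ y ∈ A, ∃ z ∈ A, x = y ^ p + ϖ * z)
    {δ : ℝ} (hδ : δ < 1) (hδA : ∀ x ∈ A, ‖σ x - x‖ ≤ δ) {x : F} (hx : x ∈ A) :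
    ‖σ x - x‖ ≤ ‖σ ϖ - ϖ‖ := by
  have hδ0 : 0 ≤ δ := (norm_nonneg _).trans (hδA x hx)
  set c := max ‖(p : F)‖ (max δ ‖ϖ‖) with hc
  have hc1 : c < 1 := max_lt hpF (max_lt hδ hϖ)
  have hc0 : 0 ≤ c := le_max_of_le_left (norm_nonneg _)
  have key (n : ℕ) : ∀ x ∈ A, ‖σ x - x‖ ≤ max (c ^ n * δ) ‖σ ϖ - ϖ‖ := by
    induction n with
    | zero => intro x hx; simpa using Or.inl (hδA x hx)
    | succ n ih =>
      intro x hx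
      obtain ⟨y, hy, z, hz, rfl⟩ := hAϖ x hx
      have hmax : max (c ^ n * δ) ‖σ ϖ - ϖ‖ * c ≤ max (c ^ (n + 1) * δ) ‖σ ϖ - ϖ‖ := by
        rw [max_mul_of_nonneg _ _ hc0]
        refine max_le_max (by rw [pow_succ]; linarith) ?_
        exact mul_le_of_le_one_right (norm_nonneg _) hc1.le
      have hsplit : σ (y ^ p + ϖ * z) - (y ^ p + ϖ * z)
          = (σ y ^ p - y ^ p) + ((σ ϖ - ϖ) * σ z + ϖ * (σ z - z)) := by
        simp only [map_add, map_pow, map_mul]; ring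
      rw [hsplit]
      refine (IsUltrametricDist.norm_add_le_max _ _).trans (max_le ?_ ?_)
      · refine (norm_pow_prime_sub_pow_le hp ((hσ y).trans_le (hA y hy)) (hA y hy)).trans
          (le_trans ?_ hmax)
        rw [mul_comm]
        refine mul_le_mul (ih y hy) ?_ (le_max_of_le_left (norm_nonneg _))
          (le_max_of_le_right (norm_nonneg _))
        exact max_le_max le_rfl (le_max_of_le_left (hδA y hy))
      · refine (IsUltrametricDist.norm_add_le_max _ _).trans (max_le ?_ ?_)
        · rw [norm_mul]
          exact le_max_of_le_right
            (mul_le_of_le_one_right (norm_nonneg _) ((hσ z).trans_le (hA z hz)))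
        · rw [norm_mul, mul_comm]
          refine le_trans (mul_le_mul (ih z hz) ?_ (norm_nonneg _)
            (le_max_of_le_right (norm_nonneg _))) hmax
          exact le_max_of_le_right (le_max_right _ _)
  have hlim : Filter.Tendsto (fun n : ℕ ↦ max (c ^ n * δ) ‖σ ϖ - ϖ‖) Filter.atTop
      (nhds (max (0 * δ) ‖σ ϖ - ϖ‖)) :=
    ((tendsto_pow_atTop_nhds_zero_of_lt_one hc0 hc1).mul_const δ).max tendsto_const_nhds
  have := ge_of_tendsto' hlim fun n ↦ key n x hx
  rwa [zero_mul, max_eq_right (norm_nonneg _)] at this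

/-- If the norms of the coefficients `a k` are powers of `‖ϖ‖ ^ n`, then the terms of
`∑ k < n, a k * ϖ ^ k` have distinct norms, so that no cancellation occurs. -/
theorem norm_coeff_zero_le_norm_sum {ϖ : F} (hϖ0 : ϖ ≠ 0) (hϖ : ‖ϖ‖ < 1) {n : ℕ} (hn : 0 < n)
    (a : ℕ → F) (ha : ∀ k, a k ≠ 0 → ∃ m : ℤ, ‖a k‖ = ‖ϖ‖ ^ (n * m)) :
    ‖a 0‖ ≤ ‖∑ k ∈ Finset.range n, a k * ϖ ^ k‖ := by
  classical
  rcases eq_or_ne (a 0) 0 with h0 | h0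
  · rw [h0, norm_zero]; exact norm_nonneg _
  have hpos : 0 < ‖ϖ‖ := norm_pos_iff.mpr hϖ0
  have hnorm (k : ℕ) (hk : a k ≠ 0) : ∃ m : ℤ, ‖a k * ϖ ^ k‖ = ‖ϖ‖ ^ (n * m + k) := by
    obtain ⟨m, hm⟩ := ha k hk
    exact ⟨m, by rw [norm_mul, norm_pow, hm, zpow_add₀ hpos.ne', zpow_natCast]⟩
  set s := (Finset.range n).filter fun k ↦ a k ≠ 0 with hs
  have hsum : ∑ k ∈ Finset.range n, a k * ϖ ^ k = ∑ k ∈ s, a k * ϖ ^ k := by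
    rw [hs, Finset.sum_filter]
    refine Finset.sum_congr rfl fun k _ ↦ ?_
    split_ifs with h
    · rfl
    · rw [not_not.mp h, zero_mul]
  have h0s : 0 ∈ s := by simp [hs, hn, h0]
  rw [hsum, IsUltrametricDist.norm_sum_eq_sup'_of_pairwise_ne ⟨0, h0s⟩]
  · refine le_trans ?_ (Finset.le_sup' (fun k ↦ ‖a k * ϖ ^ k‖) h0s)
    simp
  · intro i hi j hj hij h
    simp only [hs, Finset.coe_filter, Finset.mem_range, Set.mem_ofPred_eq] at hi hj
    obtain ⟨m, hm⟩ := hnorm i hi.2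
    obtain ⟨m', hm'⟩ := hnorm j hj.2
    have h' : ‖a i * ϖ ^ i‖ = ‖a j * ϖ ^ j‖ := h
    rw [hm, hm'] at h'
    have h2 := zpow_right_injective₀ hpos hϖ.ne h'
    have h3 := congrArg (· % (n : ℤ)) h2
    simp only [Int.mul_add_emod_self_left] at h3
    rw [Int.emod_eq_of_lt (by omega) (by omega), Int.emod_eq_of_lt (by omega) (by omega)] at h3
    exact hij (by exact_mod_cast h3)

variable {G : Type*} [Group G] [MulSemiringAction G F] (S : Subgroup G) [Fintype S]

omit [IsUltrametricDist F] in
theorem MulSemiringAction.natDegree_charpoly (ϖ : F) :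
    (MulSemiringAction.charpoly S ϖ).natDegree = Fintype.card S := by
  rw [MulSemiringAction.charpoly_eq, natDegree_prod_of_monic _ _ fun τ _ ↦ monic_X_sub_C (τ • ϖ)]
  simp

omit [IsUltrametricDist F] in
theorem prod_norm_smul_sub_eq (σ : G) (ϖ : F) :
    ∏ τ : S, ‖(σ * τ) • ϖ - ϖ‖ = ‖∑ k ∈ Finset.range (Fintype.card S),
      (σ • (MulSemiringAction.charpoly S ϖ).coeff k - (MulSemiringAction.charpoly S ϖ).coeff k)
        * ϖ ^ k‖ := by
  set q := MulSemiringAction.charpoly S ϖ with hq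
  have h0 : q.eval ϖ = 0 := by
    rw [hq, MulSemiringAction.charpoly_eq, eval_prod]
    exact Finset.prod_eq_zero (Finset.mem_univ 1) (by simp)
  have h1 : (σ • q).eval ϖ = ∏ τ : S, (ϖ - (σ * τ) • ϖ) := by
    rw [hq, MulSemiringAction.charpoly_eq, Finset.smul_prod', eval_prod]
    refine Finset.prod_congr rfl fun τ _ ↦ ?_
    rw [smul_sub, smul_X, smul_C, eval_sub, eval_X, eval_C, mul_smul]
    rfl
  have hdeg : q.natDegree = Fintype.card S := MulSemiringAction.natDegree_charpoly S ϖ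
  have hmonic : q.coeff (Fintype.card S) = 1 := by
    rw [← hdeg]; exact MulSemiringAction.monic_charpoly S ϖ
  have hsmul (k : ℕ) : (σ • q).coeff k = σ • q.coeff k := rfl
  have h2 : (σ • q - q).eval ϖ
      = ∑ k ∈ Finset.range (Fintype.card S), (σ • q.coeff k - q.coeff k) * ϖ ^ k := by
    have hle : (σ • q - q).natDegree < Fintype.card S + 1 := by
      refine Nat.lt_succ_of_le ((natDegree_sub_le _ _).trans (max_le ?_ hdeg.le))
      exact (natDegree_smul_le σ q).trans hdeg.le
    rw [eval_eq_sum_range' hle, Finset.sum_range_succ]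
    simp only [coeff_sub, hsmul, hmonic, smul_one, sub_self, zero_mul, add_zero]
  rw [← h2, eval_sub, h0, sub_zero, h1, norm_prod]
  exact Finset.prod_congr rfl fun τ _ ↦ norm_sub_rev _ _

theorem norm_coeff_charpoly_le_one (hG : ∀ (g : G) (x : F), ‖g • x‖ = ‖x‖) {ϖ : F}
    (hϖ : ‖ϖ‖ ≤ 1) (k : ℕ) : ‖(MulSemiringAction.charpoly S ϖ).coeff k‖ ≤ 1 := by
  let O := (NormedField.valuation (K := F)).integer
  have hmem (τ : S) : ‖τ • ϖ‖ ≤ 1 := (hG τ ϖ).trans_le hϖ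
  have : MulSemiringAction.charpoly S ϖ
      = (∏ τ : S, (X - C (⟨τ • ϖ, hmem τ⟩ : O))).map O.subtype := by
    rw [MulSemiringAction.charpoly_eq, Polynomial.map_prod]
    simp
  rw [this, coeff_map]
  exact ((∏ τ : S, (X - C (⟨τ • ϖ, hmem τ⟩ : O))).coeff k).2

/-- The product of the displacements of `ϖ` over the coset `σ S` is at most the displacement
by `σ` of the integral elements fixed by `S`. -/
theorem prod_norm_smul_sub_le (hG : ∀ (g : G) (x : F), ‖g • x‖ = ‖x‖) {ϖ : F} (hϖ : ‖ϖ‖ ≤ 1)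
    (σ : G) {c : ℝ} (hc : ∀ x : F, (∀ τ ∈ S, τ • x = x) → ‖x‖ ≤ 1 → ‖σ • x - x‖ ≤ c) :
    ∏ τ : S, ‖(σ * τ) • ϖ - ϖ‖ ≤ c := by
  have hc0 : 0 ≤ c := by simpa using hc 0 (by simp) (by simp)
  rw [prod_norm_smul_sub_eq]
  refine IsUltrametricDist.norm_sum_le_of_forall_le_of_nonneg hc0 fun k _ ↦ ?_
  rw [norm_mul, norm_pow]
  refine (mul_le_of_le_one_right (norm_nonneg _) (pow_le_one₀ (norm_nonneg _) hϖ)).trans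
    (hc _ (fun τ hτ ↦ ?_) (norm_coeff_charpoly_le_one S hG hϖ k))
  exact MulSemiringAction.smul_coeff_charpoly ϖ k (⟨τ, hτ⟩ : S)

/-- The product of the displacements of `ϖ` over the coset `σ S` is at least the displacement
by `σ` of the norm of `ϖ` to the field fixed by the normal subgroup `S`, when that field has
ramification index `|S|` below `F`. -/
theorem norm_smul_prod_sub_le [S.Normal] {ϖ : F} (hϖ0 : ϖ ≠ 0) (hϖ : ‖ϖ‖ < 1)
    (hS : ∀ x : F, x ≠ 0 → (∀ τ ∈ S, τ • x = x) → ∃ m : ℤ, ‖x‖ = ‖ϖ‖ ^ (Fintype.card S * m))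
    (σ : G) : ‖σ • (∏ τ : S, τ • ϖ) - ∏ τ : S, τ • ϖ‖ ≤ ∏ τ : S, ‖(σ * τ) • ϖ - ϖ‖ := by
  set q := MulSemiringAction.charpoly S ϖ with hq
  have hfix (k : ℕ) : ∀ τ ∈ S, τ • q.coeff k = q.coeff k := fun τ hτ ↦
    MulSemiringAction.smul_coeff_charpoly ϖ k (⟨τ, hτ⟩ : S)
  have h := norm_coeff_zero_le_norm_sum hϖ0 hϖ Fintype.card_pos
    (fun k ↦ σ • q.coeff k - q.coeff k) fun k hk ↦ hS _ hk fun τ hτ ↦ by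
      have h1 : τ • σ • q.coeff k = σ • q.coeff k := by
        rw [← mul_smul, ← mul_inv_cancel_left σ (τ * σ), mul_smul, ← mul_assoc, hfix k]
        exact Subgroup.Normal.conj_mem' inferInstance τ hτ σ
      rw [smul_sub, h1, hfix k τ hτ]
  rw [prod_norm_smul_sub_eq]
  refine le_of_eq_of_le ?_ h
  have hc0 : q.coeff 0 = (-1) ^ Fintype.card S * ∏ τ : S, τ • ϖ := by
    rw [hq, MulSemiringAction.charpoly_eq, coeff_zero_eq_eval_zero, eval_prod]
    simp [Finset.prod_neg, Subgroup.smul_def]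
  simp only [hc0, smul_mul', smul_pow', smul_neg, smul_one]
  rw [← mul_sub, norm_mul, norm_pow, norm_neg, norm_one, one_pow, one_mul]

end Displacement

/-! ### The valuation ring of a finite extension of `ℚ_[p]` -/

namespace LocalRamification

open IsLocalRing

section Finite

variable (p : ℕ) [Fact p.Prime] (L : Type*) [Field L] [Algebra ℚ_[p] L]

section Algebraic

variable [Algebra.IsAlgebraic ℚ_[p] L]

variable {p L} in
theorem mem_integers_iff {x : L} : x ∈ integers p L ↔ spectralNorm ℚ_[p] L x ≤ 1 := Iff.rfl

variable {p L} in
theorem mem_maxIdeal_iff {x : integers p L} :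
    x ∈ maxIdeal p L ↔ spectralNorm ℚ_[p] L (x : L) < 1 := by
  let := spectralNorm.normedField ℚ_[p] L
  change _ ↔ ‖(x : L)‖ < 1
  have hx : ‖(x : L)‖ ≤ 1 := x.2
  rw [mem_maximalIdeal, mem_nonunits_iff, not_iff_comm, not_lt]
  constructor
  · intro h
    have h0 : (x : L) ≠ 0 := norm_pos_iff.mp (one_pos.trans_le h)
    have hinv : ‖(x : L)⁻¹‖ ≤ 1 := by rw [norm_inv]; exact inv_le_one_of_one_le₀ h
    refine .of_mul_eq_one (⟨(x : L)⁻¹, hinv⟩ : integers p L) (Subtype.ext ?_)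
    exact mul_inv_cancel₀ h0
  · intro h
    obtain ⟨y, hy⟩ := h.exists_right_inv
    have hy1 : ‖(y : L)‖ ≤ 1 := y.2
    have hxy : (x : L) * (y : L) = 1 := congrArg Subtype.val hy
    have : ‖(x : L)‖ * ‖(y : L)‖ = 1 := by rw [← norm_mul, hxy, norm_one]
    nlinarith [norm_nonneg (x : L)]

omit [Algebra.IsAlgebraic ℚ_[p] L] in
theorem spectralNorm_natCast_prime_lt_one : spectralNorm ℚ_[p] L (p : L) < 1 := by
  have := spectralNorm_extends (L := L) (p : ℚ_[p])
  rw [map_natCast] at this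
  rw [this]
  exact Padic.norm_p_lt_one

theorem not_isField_integers : ¬ IsField (integers p L) := by
  intro h
  have hp : (p : integers p L) ∈ maxIdeal p L :=
    mem_maxIdeal_iff.mpr (spectralNorm_natCast_prime_lt_one p L)
  rw [show maxIdeal p L = ⊥ from isField_iff_maximalIdeal_eq.mp h, Ideal.mem_bot] at hp
  have : ((p : integers p L) : L) = 0 := congrArg Subtype.val hp
  have h2 : algebraMap ℚ_[p] L p = 0 := by rw [map_natCast]; exact this
  rw [map_eq_zero_iff _ (algebraMap ℚ_[p] L).injective, Nat.cast_eq_zero] at h2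
  exact (Fact.out : p.Prime).ne_zero h2

/-- The spectral norm extends the `p`-adic absolute value, so `ℤ_[p]` maps to the valuation ring. -/
noncomputable instance algebraPadicInt : Algebra ℤ_[p] (integers p L) :=
  (((algebraMap ℚ_[p] L).comp (algebraMap ℤ_[p] ℚ_[p])).codRestrict (integers p L).toSubring
    fun x ↦ (spectralNorm_extends (L := L) (x : ℚ_[p])).trans_le x.2).toAlgebra

theorem coe_algebraMap_padicInt (x : ℤ_[p]) :
    (algebraMap ℤ_[p] (integers p L) x : L) = algebraMap ℚ_[p] L x := rfl

/-- The elements of the valuation ring are integral over `ℤ_[p]`, as the spectral norm is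
computed by the coefficients of the minimal polynomial. -/
theorem exists_monic_eval₂_eq_zero (x : integers p L) :
    ∃ f : Polynomial ℤ_[p], f.Monic ∧
      f.eval₂ ((algebraMap ℚ_[p] L).comp (algebraMap ℤ_[p] ℚ_[p])) (x : L) = 0 := by
  have hmonic : (minpoly ℚ_[p] (x : L)).Monic :=
    minpoly.monic (Algebra.IsIntegral.isIntegral (x : L))
  have hx := (spectralValue_le_one_iff hmonic).mp x.2
  have hlift : minpoly ℚ_[p] (x : L) ∈ Polynomial.lifts (algebraMap ℤ_[p] ℚ_[p]) := by
    rw [Polynomial.lifts_iff_coeff_lifts]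
    exact fun n ↦ ⟨⟨_, hx n⟩, rfl⟩
  obtain ⟨f, hf, -, hfm⟩ := Polynomial.lifts_and_degree_eq_and_monic hlift hmonic
  refine ⟨f, hfm, ?_⟩
  rw [← Polynomial.eval₂_map, hf]
  exact minpoly.aeval ℚ_[p] (x : L)

end Algebraic

variable [FiniteDimensional ℚ_[p] L]

instance finite_integers : Module.Finite ℤ_[p] (integers p L) := by
  let : Algebra ℤ_[p] L := ((algebraMap ℚ_[p] L).comp (algebraMap ℤ_[p] ℚ_[p])).toAlgebra
  have : IsScalarTower ℤ_[p] ℚ_[p] L := IsScalarTower.of_algebraMap_eq fun _ ↦ rfl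
  have : IsNoetherian ℤ_[p] (integralClosure ℤ_[p] L) :=
    IsIntegralClosure.isNoetherian ℤ_[p] ℚ_[p] L (integralClosure ℤ_[p] L)
  let f : integers p L →ₗ[ℤ_[p]] integralClosure ℤ_[p] L :=
    { toFun := fun x ↦ ⟨x, exists_monic_eval₂_eq_zero p L x⟩
      map_add' := fun _ _ ↦ rfl
      map_smul' := fun a x ↦ Subtype.ext <| by
        rw [Algebra.smul_def, Algebra.smul_def]; rfl }
  have hf : Function.Injective f := fun x y h ↦
    Subtype.ext (congrArg (fun z : integralClosure ℤ_[p] L ↦ (z : L)) h)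
  have := isNoetherian_of_injective f hf
  infer_instance

instance isDiscreteValuationRing_integers : IsDiscreteValuationRing (integers p L) := by
  have : IsNoetherianRing (integers p L) := IsNoetherianRing.of_finite ℤ_[p] (integers p L)
  have h : IsDiscreteValuationRing (integers p L) ↔ ValuationRing (integers p L) :=
    (IsDiscreteValuationRing.TFAE (integers p L) (not_isField_integers p L)).out 0 1
  exact h.mpr inferInstance

instance finite_residueField : Finite (ResidueField (integers p L)) := by
  have : IsLocalHom (algebraMap ℤ_[p] (integers p L)) := by
    have : FaithfulSMul ℤ_[p] (integers p L) := by
      rw [faithfulSMul_iff_algebraMap_injective]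
      intro x y h
      have := congrArg (fun z : integers p L ↦ (z : L)) h
      exact Subtype.ext ((algebraMap ℚ_[p] L).injective this)
    have : Algebra.IsIntegral ℤ_[p] (integers p L) := Algebra.IsIntegral.of_finite _ _
    infer_instance
  have : Finite (ResidueField ℤ_[p]) := Finite.of_equiv _ PadicInt.residueField.toEquiv.symm
  exact Module.finite_of_finite (ResidueField ℤ_[p])

variable {p L}

theorem maxIdeal_eq_span {ϖ : integers p L} (hϖ : Irreducible ϖ) :
    maxIdeal p L = Ideal.span {ϖ} :=
  hϖ.maximalIdeal_eq

theorem spectralNorm_lt_one_of_irreducible {ϖ : integers p L} (hϖ : Irreducible ϖ) :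
    spectralNorm ℚ_[p] L ϖ < 1 := by
  rw [← mem_maxIdeal_iff, maxIdeal_eq_span hϖ]
  exact Ideal.mem_span_singleton_self ϖ

theorem spectralNorm_pos_of_irreducible {ϖ : integers p L} (hϖ : Irreducible ϖ) :
    0 < spectralNorm ℚ_[p] L ϖ :=
  spectralNorm_zero_lt (fun h ↦ hϖ.ne_zero (Subtype.ext h)) (Algebra.IsAlgebraic.isAlgebraic _)

theorem mem_maxIdeal_pow_iff {ϖ : integers p L} (hϖ : Irreducible ϖ) (n : ℕ) {x : integers p L} :
    x ∈ maxIdeal p L ^ n ↔ spectralNorm ℚ_[p] L x ≤ spectralNorm ℚ_[p] L ϖ ^ n := by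
  have hpos := spectralNorm_pos_of_irreducible hϖ
  rw [maxIdeal_eq_span hϖ, Ideal.span_singleton_pow, Ideal.mem_span_singleton]
  let := spectralNorm.normedField ℚ_[p] L
  change _ ↔ ‖(x : L)‖ ≤ ‖(ϖ : L)‖ ^ n
  replace hpos : 0 < ‖(ϖ : L)‖ := hpos
  constructor
  · rintro ⟨y, rfl⟩
    have hy : ‖(y : L)‖ ≤ 1 := y.2
    have : ((ϖ ^ n * y : integers p L) : L) = (ϖ : L) ^ n * y := rfl
    rw [this, norm_mul, norm_pow]
    exact mul_le_of_le_one_right (by positivity) hy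
  · intro h
    have hy : ‖(x : L) / (ϖ : L) ^ n‖ ≤ 1 := by
      rw [norm_div, norm_pow]
      exact div_le_one_of_le₀ h (by positivity)
    refine ⟨⟨(x : L) / (ϖ : L) ^ n, hy⟩, Subtype.ext ?_⟩
    have : (ϖ : L) ^ n ≠ 0 := pow_ne_zero _ (norm_pos_iff.mp hpos)
    exact (mul_div_cancel₀ (x : L) this).symm

theorem exists_spectralNorm_eq_pow {ϖ : integers p L} (hϖ : Irreducible ϖ) {x : integers p L}
    (hx : x ≠ 0) : ∃ n : ℕ, spectralNorm ℚ_[p] L x = spectralNorm ℚ_[p] L ϖ ^ n := by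
  obtain ⟨n, hn⟩ := IsDiscreteValuationRing.associated_pow_irreducible hx hϖ
  refine ⟨n, le_antisymm ?_ ?_⟩
  · rw [← mem_maxIdeal_pow_iff hϖ, maxIdeal_eq_span hϖ, Ideal.span_singleton_pow,
      Ideal.mem_span_singleton]
    exact hn.symm.dvd
  · obtain ⟨y, hy⟩ := hn.dvd
    let := spectralNorm.normedField ℚ_[p] L
    change ‖(ϖ : L)‖ ^ n ≤ ‖(x : L)‖
    rw [← norm_pow]
    have h1 : (ϖ : L) ^ n = (x : L) * y := congrArg (fun z : integers p L ↦ (z : L)) hy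
    have hy1 : ‖(y : L)‖ ≤ 1 := y.2
    rw [h1, norm_mul]
    exact mul_le_of_le_one_right (norm_nonneg _) hy1

theorem exists_spectralNorm_eq_zpow {ϖ : integers p L} (hϖ : Irreducible ϖ) {x : L}
    (hx : x ≠ 0) : ∃ n : ℤ, spectralNorm ℚ_[p] L x = spectralNorm ℚ_[p] L ϖ ^ n := by
  rcases (integers p L).mem_or_inv_mem x with h | h
  · obtain ⟨n, hn⟩ := exists_spectralNorm_eq_pow hϖ (x := ⟨x, h⟩) fun h' ↦
      hx (congrArg Subtype.val h')
    exact ⟨n, by rw [zpow_natCast]; exact hn⟩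
  · obtain ⟨n, hn⟩ := exists_spectralNorm_eq_pow hϖ (x := ⟨x⁻¹, h⟩) fun h' ↦
      inv_ne_zero hx (congrArg Subtype.val h')
    refine ⟨-n, ?_⟩
    let := spectralNorm.normedField ℚ_[p] L
    change ‖x‖ = ‖(ϖ : L)‖ ^ (-(n : ℤ))
    replace hn : ‖x⁻¹‖ = ‖(ϖ : L)‖ ^ n := hn
    rw [zpow_neg, zpow_natCast, ← hn, norm_inv, inv_inv]

theorem irreducible_of_spectralNorm_eq {ϖ x : integers p L} (hϖ : Irreducible ϖ)
    (h : spectralNorm ℚ_[p] L x = spectralNorm ℚ_[p] L ϖ) : Irreducible x := by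
  rw [IsDiscreteValuationRing.irreducible_iff_uniformizer]
  change maxIdeal p L = _
  have hpos := spectralNorm_pos_of_irreducible hϖ
  have h0 : x ≠ 0 := by
    rintro rfl
    rw [← h] at hpos
    exact hpos.ne' spectralNorm_zero
  obtain ⟨n, hn⟩ := IsDiscreteValuationRing.associated_pow_irreducible h0 hϖ
  obtain ⟨y, hy⟩ : ϖ ∣ x := by
    rw [← Ideal.mem_span_singleton, ← maxIdeal_eq_span hϖ, mem_maxIdeal_iff, h]
    exact spectralNorm_lt_one_of_irreducible hϖ
  have hy1 : IsUnit y := by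
    by_contra hy1
    have hlt : spectralNorm ℚ_[p] L y < 1 := mem_maxIdeal_iff.mp hy1
    let := spectralNorm.normedField ℚ_[p] L
    have hxy : (x : L) = ϖ * y := congrArg Subtype.val hy
    have h2 : ‖(x : L)‖ = ‖(ϖ : L)‖ := h
    rw [hxy, norm_mul] at h2
    replace hlt : ‖(y : L)‖ < 1 := hlt
    replace hpos : 0 < ‖(ϖ : L)‖ := hpos
    nlinarith
  rw [maxIdeal_eq_span hϖ, hy, Ideal.span_singleton_mul_right_unit hy1]

/-- The residue field is finite, hence perfect. -/
theorem exists_eq_pow_add_mul {ϖ : integers p L} (hϖ : Irreducible ϖ) (x : integers p L) :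
    ∃ y z : integers p L, x = y ^ p + ϖ * z := by
  have hp0 : (p : ResidueField (integers p L)) = 0 := by
    rw [← map_natCast (residue (integers p L)), residue_eq_zero_iff]
    exact mem_maxIdeal_iff.mpr (spectralNorm_natCast_prime_lt_one p L)
  have : CharP (ResidueField (integers p L)) p :=
    (CharP.charP_iff_prime_eq_zero Fact.out).mpr hp0
  obtain ⟨y', hy'⟩ := surjective_frobenius (ResidueField (integers p L)) p
    (residue (integers p L) x)
  obtain ⟨y, rfl⟩ := residue_surjective y'
  have h : x - y ^ p ∈ maxIdeal p L := by
    rw [← residue_eq_zero_iff, map_sub, map_pow, ← hy', frobenius_def, sub_self]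
  rw [maxIdeal_eq_span hϖ, Ideal.mem_span_singleton] at h
  obtain ⟨z, hz⟩ := h
  exact ⟨y, z, by rw [← hz]; ring⟩

end Finite

end LocalRamification

/-! ### Inertia groups and ramification indices -/

namespace LocalRamification

open IsLocalRing

section Tower

variable (p : ℕ) [Fact p.Prime] (K F : Type*) [Field K] [Field F] [Algebra ℚ_[p] K]
  [Algebra ℚ_[p] F] [Algebra K F] [IsScalarTower ℚ_[p] K F]

section Algebraic

variable [Algebra.IsAlgebraic ℚ_[p] F]

/-- The action of `Gal(F/K)` on the valuation ring, as an action by ring automorphisms. -/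
instance galMulSemiringAction : MulSemiringAction Gal(F/K) (integers p F) where
  __ := galAction p K F
  smul_zero σ := Subtype.ext (map_zero σ)
  smul_add σ x y := Subtype.ext (map_add σ (x : F) y)
  smul_one σ := Subtype.ext (map_one σ)
  smul_mul σ x y := Subtype.ext (map_mul σ (x : F) y)

variable {K F} in
theorem coe_gal_smul (σ : Gal(F/K)) (x : integers p F) : ((σ • x : integers p F) : F) = σ x := rfl

omit [Algebra.IsAlgebraic ℚ_[p] F] in
variable {K F} in
theorem spectralNorm_gal_apply (σ : Gal(F/K)) (x : F) :
    spectralNorm ℚ_[p] F (σ x) = spectralNorm ℚ_[p] F x :=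
  (spectralNorm_eq_of_equiv (K := ℚ_[p]) (σ.restrictScalars ℚ_[p]) x).symm

variable {K F} in
theorem coe_gal_smul_sub (σ : Gal(F/K)) (x : integers p F) :
    ((σ • x - x : integers p F) : F) = σ x - x := rfl

variable {p K F} in
theorem mem_lowerGroup_iff {u : ℝ} {σ : Gal(F/K)} : σ ∈ lowerGroup p K F u ↔
    ∀ x : integers p F, σ • x - x ∈ maxIdeal p F ^ ⌈u + 1⌉₊ := Iff.rfl

variable {p K F} in
theorem mem_lowerGroup_zero {σ : Gal(F/K)} : σ ∈ lowerGroup p K F 0 ↔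
    ∀ x : F, spectralNorm ℚ_[p] F x ≤ 1 → spectralNorm ℚ_[p] F (σ x - x) < 1 := by
  rw [mem_lowerGroup_iff, zero_add, Nat.ceil_one, pow_one]
  simp only [mem_maxIdeal_iff, coe_gal_smul_sub]
  exact ⟨fun h x hx ↦ h (⟨x, hx⟩ : integers p F), fun h x ↦ h x x.2⟩

variable [Algebra.IsAlgebraic ℚ_[p] K]

/-- The valuation ring of `K` maps to that of `F`, as the spectral norm does not depend on the
field. -/
noncomputable instance algebraIntegers : Algebra (integers p K) (integers p F) :=
  (((algebraMap K F).comp (integers p K).subtype).codRestrict (integers p F).toSubring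
    fun x ↦ (spectralNorm.eq_of_tower (L := F) (x : K)).symm.trans_le x.2).toAlgebra

theorem coe_algebraMap_integers (x : integers p K) :
    (algebraMap (integers p K) (integers p F) x : F) = algebraMap K F x := rfl

instance isScalarTower_integers : IsScalarTower ℤ_[p] (integers p K) (integers p F) :=
  IsScalarTower.of_algebraMap_eq fun x ↦ Subtype.ext <| by
    rw [coe_algebraMap_integers, coe_algebraMap_padicInt, coe_algebraMap_padicInt,
      ← IsScalarTower.algebraMap_apply]

instance isGaloisGroup_integers [FiniteDimensional K F] [IsGalois K F] :
    IsGaloisGroup Gal(F/K) (integers p K) (integers p F) where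
  faithful := ⟨fun {σ τ} h ↦ by
    ext x
    rcases (integers p F).mem_or_inv_mem x with hx | hx
    · exact congrArg Subtype.val (h ⟨x, hx⟩)
    · have := congrArg Subtype.val (h ⟨x⁻¹, hx⟩)
      rw [coe_gal_smul, coe_gal_smul, map_inv₀, map_inv₀] at this
      exact inv_injective this⟩
  commutes := ⟨fun σ a x ↦ Subtype.ext <| by
    rw [Algebra.smul_def, Algebra.smul_def, coe_gal_smul]
    exact (map_mul σ _ _).trans (congrArg (· * _) (σ.commutes _))⟩
  isInvariant := ⟨fun x hx ↦ by
    have h : (x : F) ∈ Set.range (algebraMap K F) := by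
      rw [IsGalois.mem_range_algebraMap_iff_fixed]
      exact fun σ ↦ congrArg Subtype.val (hx σ)
    obtain ⟨y, hy⟩ := h
    refine ⟨⟨y, ?_⟩, Subtype.ext hy⟩
    rw [mem_integers_iff, spectralNorm.eq_of_tower (L := F), hy]
    exact x.2⟩

end Algebraic

variable [FiniteDimensional ℚ_[p] K] [FiniteDimensional ℚ_[p] F] [FiniteDimensional K F]

instance finite_integers_integers : Module.Finite (integers p K) (integers p F) :=
  Module.Finite.of_restrictScalars_finite ℤ_[p] _ _

instance liesOver_maxIdeal : (maxIdeal p F).LiesOver (maxIdeal p K) :=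
  ⟨by
    ext x
    rw [Ideal.mem_comap, mem_maxIdeal_iff, mem_maxIdeal_iff, coe_algebraMap_integers,
      spectralNorm.eq_of_tower (L := F)]⟩

instance finite_maxIdeal_residueField : Finite (maxIdeal p K).ResidueField :=
  have : Finite (integers p K ⧸ maxIdeal p K) := finite_residueField p K
  Finite.of_surjective _ (Ideal.bijective_algebraMap_quotient_residueField (maxIdeal p K)).2

variable {p K F} in
/-- The order of the inertia group is the ramification index. -/
theorem spectralNorm_eq_pow_card_lowerGroup [IsGalois K F] {ϖK : integers p K}
    {ϖF : integers p F} (hK : Irreducible ϖK) (hF : Irreducible ϖF) :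
    spectralNorm ℚ_[p] K ϖK = spectralNorm ℚ_[p] F ϖF ^ Nat.card (lowerGroup p K F 0) := by
  have hinj : Function.Injective (algebraMap (integers p K) (integers p F)) := fun x y h ↦
    Subtype.ext ((algebraMap K F).injective (congrArg Subtype.val h))
  have : FaithfulSMul (integers p K) (integers p F) :=
    (faithfulSMul_iff_algebraMap_injective _ _).mpr hinj
  have : Module.IsTorsionFree (integers p K) (integers p F) := inferInstance
  have h1 : lowerGroup p K F 0 = Ideal.inertia Gal(F/K) (maxIdeal p F) := by
    rw [lowerGroup, zero_add, Nat.ceil_one, pow_one]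
  have hbot : maxIdeal p K ≠ ⊥ :=
    fun h ↦ not_isField_integers p K (isField_iff_maximalIdeal_eq.mpr h)
  -- Mathlib's count of the inertia group, in terms of the largest power of the maximal ideal of `F`
  -- that contains the maximal ideal of `K`.
  have h2 : Nat.card (lowerGroup p K F 0) = Ideal.ramificationIdx' (maxIdeal p K)
      (maxIdeal p F) := by
    rw [h1, Ideal.card_inertia_eq_ramificationIdxIn (maxIdeal p K) (maxIdeal p F),
      Ideal.ramificationIdxIn_eq_ramificationIdx (maxIdeal p K) (maxIdeal p F) Gal(F/K)]
    exact (Ideal.ramificationIdx'_eq_ramificationIdx _ _ hbot).symm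
  have hϖ : algebraMap (integers p K) (integers p F) ϖK ≠ 0 :=
    (map_ne_zero_iff _ hinj).mpr hK.ne_zero
  obtain ⟨n, hn⟩ := exists_spectralNorm_eq_pow hF hϖ
  have hmap (k : ℕ) : (maxIdeal p K).map (algebraMap (integers p K) (integers p F)) ≤
      maxIdeal p F ^ k ↔ spectralNorm ℚ_[p] F ϖF ^ n ≤ spectralNorm ℚ_[p] F ϖF ^ k := by
    rw [maxIdeal_eq_span hK, Ideal.map_span, Set.image_singleton, Ideal.span_singleton_le_iff_mem,
      mem_maxIdeal_pow_iff hF, hn]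
  rw [h2, Ideal.ramificationIdx'_spec ((hmap n).mpr le_rfl), spectralNorm.eq_of_tower (L := F),
    ← coe_algebraMap_integers, hn]
  rw [hmap, not_le]
  exact pow_lt_pow_right_of_lt_one₀ (spectralNorm_pos_of_irreducible hF)
    (spectralNorm_lt_one_of_irreducible hF) n.lt_succ_self

end Tower

end LocalRamification

/-! ### Fixed fields of subgroups of the inertia group -/

namespace LocalRamification

open IsLocalRing

section FixedField

variable {p : ℕ} [Fact p.Prime] {K F : Type*} [Field K] [Field F] [Algebra ℚ_[p] K]
  [Algebra ℚ_[p] F] [Algebra K F] [IsScalarTower ℚ_[p] K F]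
  [FiniteDimensional ℚ_[p] K] [FiniteDimensional ℚ_[p] F] [FiniteDimensional K F]

instance isScalarTower_intermediateField (M : IntermediateField K F) :
    IsScalarTower ℚ_[p] M F :=
  IsScalarTower.of_algebraMap_eq fun _ ↦ rfl

instance finiteDimensional_intermediateField (M : IntermediateField K F) :
    FiniteDimensional ℚ_[p] M :=
  Module.Finite.trans K M

omit [FiniteDimensional ℚ_[p] K] [FiniteDimensional ℚ_[p] F] [FiniteDimensional K F] in
theorem spectralNorm_coe_intermediateField (M : IntermediateField K F) (x : M) :
    spectralNorm ℚ_[p] F (x : F) = spectralNorm ℚ_[p] M x :=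
  (spectralNorm.eq_of_tower (L := F) x).symm

/-- If `T` is contained in the inertia group then `F` is totally ramified over its fixed field. -/
theorem spectralNorm_eq_pow_card_of_le_lowerGroup [IsGalois K F] {T : Subgroup Gal(F/K)}
    (hT : T ≤ lowerGroup p K F 0) {ϖM : integers p (IntermediateField.fixedField T)}
    {ϖF : integers p F} (hM : Irreducible ϖM) (hF : Irreducible ϖF) :
    spectralNorm ℚ_[p] F (ϖM : IntermediateField.fixedField T)
      = spectralNorm ℚ_[p] F ϖF ^ Nat.card T := by
  have h := spectralNorm_eq_pow_card_lowerGroup hM hF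
  rw [spectralNorm_coe_intermediateField, h]
  have htop : lowerGroup p (IntermediateField.fixedField T) F 0 = ⊤ := by
    rw [eq_top_iff]
    intro σ _
    rw [mem_lowerGroup_zero]
    have h1 : ((IntermediateField.subgroupEquivAlgEquiv T).symm σ).1 ∈ lowerGroup p K F 0 :=
      hT (Subtype.prop _)
    rw [mem_lowerGroup_zero] at h1
    intro x hx
    have h2 : ((IntermediateField.subgroupEquivAlgEquiv T).symm σ).1 x = σ x := by
      conv_rhs => rw [← (IntermediateField.subgroupEquivAlgEquiv T).apply_symm_apply σ]
      rfl
    rw [← h2]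
    exact h1 x hx
  rw [htop, Subgroup.card_top, Nat.card_congr (IntermediateField.subgroupEquivAlgEquiv T).toEquiv]

theorem exists_spectralNorm_eq_zpow_of_fixed [IsGalois K F] {T : Subgroup Gal(F/K)}
    (hT : T ≤ lowerGroup p K F 0) {ϖ : integers p F} (hϖ : Irreducible ϖ) {x : F} (hx : x ≠ 0)
    (hxT : ∀ τ ∈ T, τ x = x) :
    ∃ m : ℤ, spectralNorm ℚ_[p] F x = spectralNorm ℚ_[p] F ϖ ^ (Nat.card T * m) := by
  set M := IntermediateField.fixedField T with hM
  obtain ⟨ϖM, hϖM⟩ := IsDiscreteValuationRing.exists_irreducible (integers p M)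
  have hxM : x ∈ M := fun τ ↦ hxT τ τ.2
  obtain ⟨m, hm⟩ := exists_spectralNorm_eq_zpow hϖM (x := ⟨x, hxM⟩)
    (fun h ↦ hx (congrArg Subtype.val h))
  refine ⟨m, ?_⟩
  have h := spectralNorm_eq_pow_card_of_le_lowerGroup hT hϖM hϖ
  rw [spectralNorm_coe_intermediateField] at h
  rw [zpow_mul, zpow_natCast, ← h, ← hm]
  exact spectralNorm_coe_intermediateField M ⟨x, hxM⟩

/-- Among the integral elements fixed by a group `T` of inertia automorphisms, an inertia
automorphism moves the uniformizers of the fixed field the most. -/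
theorem spectralNorm_sub_le_of_fixed [IsGalois K F] {T : Subgroup Gal(F/K)}
    (hT : T ≤ lowerGroup p K F 0) {ϖ : integers p F} (hϖ : Irreducible ϖ) {c : F}
    (hcT : ∀ τ ∈ T, τ c = c)
    (hc : spectralNorm ℚ_[p] F c = spectralNorm ℚ_[p] F ϖ ^ Nat.card T)
    {σ : Gal(F/K)} (hσ : σ ∈ lowerGroup p K F 0) {x : F} (hxT : ∀ τ ∈ T, τ x = x)
    (hx : spectralNorm ℚ_[p] F x ≤ 1) :
    spectralNorm ℚ_[p] F (σ x - x) ≤ spectralNorm ℚ_[p] F (σ c - c) := by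
  set M := IntermediateField.fixedField T with hM
  obtain ⟨ϖM, hϖM⟩ := IsDiscreteValuationRing.exists_irreducible (integers p M)
  have hnorm := spectralNorm_eq_pow_card_of_le_lowerGroup hT hϖM hϖ
  have hcM : c ∈ M := fun τ ↦ hcT τ τ.2
  have hcM' : spectralNorm ℚ_[p] M ⟨c, hcM⟩ = spectralNorm ℚ_[p] M ϖM := by
    rw [← spectralNorm_coe_intermediateField, ← spectralNorm_coe_intermediateField]
    exact hc.trans hnorm.symm
  have hcint : (⟨c, hcM⟩ : M) ∈ integers p M := hcM'.trans_le ϖM.2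
  have hcirr : Irreducible (⟨⟨c, hcM⟩, hcint⟩ : integers p M) :=
    irreducible_of_spectralNorm_eq hϖM hcM'
  have hc1 : spectralNorm ℚ_[p] F c < 1 := by
    have := spectralNorm_lt_one_of_irreducible hcirr
    rwa [← spectralNorm_coe_intermediateField] at this
  let := spectralNorm.normedField ℚ_[p] F
  have : IsUltrametricDist F :=
    IsUltrametricDist.isUltrametricDist_of_isNonarchimedean_norm isNonarchimedean_spectralNorm
  refine norm_map_sub_le_of_forall_exists_pow (p := p) Fact.out
    (spectralNorm_natCast_prime_lt_one p F) (σ : F →+* F) (spectralNorm_gal_apply p σ)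
    (A := {x : F | x ∈ M ∧ spectralNorm ℚ_[p] F x ≤ 1}) (fun x hx ↦ hx.2) hc1 ?_
    (spectralNorm_lt_one_of_irreducible hϖ) ?_ (x := x) ⟨fun τ ↦ hxT τ τ.2, hx⟩
  · rintro x ⟨hxM, hx⟩
    have hxint : (⟨x, hxM⟩ : M) ∈ integers p M := by
      rw [mem_integers_iff, ← spectralNorm_coe_intermediateField]
      exact hx
    obtain ⟨y, z, hyz⟩ := exists_eq_pow_add_mul hcirr ⟨⟨x, hxM⟩, hxint⟩
    have hint (y : integers p M) : spectralNorm ℚ_[p] F ((y : M) : F) ≤ 1 :=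
      (spectralNorm_coe_intermediateField M (y : M)).trans_le y.2
    exact ⟨(y : M), ⟨y.1.2, hint y⟩, (z : M), ⟨z.1.2, hint z⟩,
      congrArg (fun w : integers p M ↦ ((w : M) : F)) hyz⟩
  · rintro x ⟨-, hx⟩
    have h1 := mem_lowerGroup_iff.mp hσ ⟨x, hx⟩
    rw [zero_add, Nat.ceil_one, mem_maxIdeal_pow_iff hϖ, pow_one] at h1
    exact h1

end FixedField

end LocalRamification

/-! ### The Herbrand function and the upper numbering -/

namespace LocalRamification

open IsLocalRing

section Herbrand

variable {p : ℕ} [Fact p.Prime] {K F : Type*} [Field K] [Field F]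
  [Algebra ℚ_[p] F] [Algebra K F] [FiniteDimensional ℚ_[p] F]

variable (p K F) in
/-- The absolute value of `σ ϖ - ϖ`. For a uniformizer `ϖ` and `σ` in the inertia group it is
`‖ϖ‖ ^ i(σ)`, where `i` is the usual index function of ramification theory. -/
noncomputable def displacement (ϖ : integers p F) (σ : Gal(F/K)) : ℝ :=
  spectralNorm ℚ_[p] F (σ ϖ - ϖ)

theorem displacement_nonneg (ϖ : integers p F) (σ : Gal(F/K)) : 0 ≤ displacement p K F ϖ σ :=
  spectralNorm_nonneg _

theorem displacement_one (ϖ : integers p F) : displacement p K F ϖ 1 = 0 := by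
  simp [displacement, spectralNorm_zero]

variable [Algebra ℚ_[p] K] [IsScalarTower ℚ_[p] K F]

theorem displacement_mul (ϖ : integers p F) (σ τ : Gal(F/K)) :
    displacement p K F ϖ (σ * τ) ≤ max (displacement p K F ϖ σ) (displacement p K F ϖ τ) := by
  have h : (σ * τ) (ϖ : F) - ϖ = σ (τ ϖ - ϖ) + (σ ϖ - ϖ) := by
    rw [map_sub, AlgEquiv.mul_apply]; ring
  rw [displacement, h, max_comm]
  refine (isNonarchimedean_spectralNorm _ _).trans (max_le_max ?_ le_rfl)
  rw [spectralNorm_gal_apply]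
  exact le_rfl

theorem displacement_inv (ϖ : integers p F) (σ : Gal(F/K)) :
    displacement p K F ϖ σ⁻¹ = displacement p K F ϖ σ := by
  have h : σ⁻¹ (ϖ : F) - ϖ = - σ⁻¹ (σ ϖ - ϖ) := by
    rw [map_sub, ← AlgEquiv.mul_apply, inv_mul_cancel]; simp
  rw [displacement, h, spectralNorm_neg (Algebra.IsAlgebraic.isAlgebraic _),
    spectralNorm_gal_apply, displacement]

theorem displacement_le {ϖ : integers p F} (hϖ : Irreducible ϖ) {σ : Gal(F/K)}
    (hσ : σ ∈ lowerGroup p K F 0) : displacement p K F ϖ σ ≤ spectralNorm ℚ_[p] F ϖ := by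
  have h1 := mem_lowerGroup_iff.mp hσ ϖ
  rwa [zero_add, Nat.ceil_one, mem_maxIdeal_pow_iff hϖ, pow_one] at h1

theorem lowerGroup_le_zero {u : ℝ} (hu : 0 ≤ u) : lowerGroup p K F u ≤ lowerGroup p K F 0 :=
  fun _ hσ x ↦ Ideal.pow_le_pow_right (Nat.ceil_mono (by linarith)) (hσ x)

variable [FiniteDimensional K F]

noncomputable instance fintype_lowerGroup (u : ℝ) : Fintype (lowerGroup p K F u) :=
  Fintype.ofFinite _

variable (p K F) in
/-- The Herbrand function in multiplicative form: the product over the inertia group of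
`max ‖σ ϖ - ϖ‖ t`. -/
noncomputable def herbrandProd (ϖ : integers p F) (t : ℝ) : ℝ :=
  ∏ g : lowerGroup p K F 0, max (displacement p K F ϖ g) t

theorem herbrandProd_lt_herbrandProd (ϖ : integers p F) {s t : ℝ} (ht : 0 < t) (hst : t < s) :
    herbrandProd p K F ϖ t < herbrandProd p K F ϖ s := by
  classical
  rw [herbrandProd, herbrandProd, ← Finset.mul_prod_erase _ _ (Finset.mem_univ 1),
    ← Finset.mul_prod_erase _ _ (Finset.mem_univ 1)]
  simp only [OneMemClass.coe_one, displacement_one]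
  rw [max_eq_right ht.le, max_eq_right (ht.trans hst).le]
  refine mul_lt_mul hst ?_ ?_ (ht.trans hst).le
  · exact Finset.prod_le_prod (fun _ _ ↦ le_max_of_le_right ht.le) fun _ _ ↦
      max_le_max le_rfl hst.le
  · exact Finset.prod_pos fun _ _ ↦ lt_max_of_lt_right ht

theorem herbrandProd_le_iff (ϖ : integers p F) {s t : ℝ} (hs : 0 ≤ s) (ht : 0 < t) :
    herbrandProd p K F ϖ s ≤ herbrandProd p K F ϖ t ↔ s ≤ t := by
  constructor
  · intro h
    by_contra! h'
    exact (herbrandProd_lt_herbrandProd ϖ ht h').not_ge h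
  · rintro h
    exact Finset.prod_le_prod (fun _ _ ↦ le_max_of_le_right hs) fun _ _ ↦ max_le_max le_rfl h

variable [FiniteDimensional ℚ_[p] K]

/-- The displacement of a uniformizer determines the lower numbering. -/
theorem mem_lowerGroup_iff_displacement_le [IsGalois K F] {ϖ : integers p F}
    (hϖ : Irreducible ϖ) {σ : Gal(F/K)} (hσ : σ ∈ lowerGroup p K F 0) (u : ℝ) :
    σ ∈ lowerGroup p K F u ↔
      displacement p K F ϖ σ ≤ spectralNorm ℚ_[p] F ϖ ^ (u + 1) := by
  have hpos := spectralNorm_pos_of_irreducible hϖ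
  have hlt := spectralNorm_lt_one_of_irreducible hϖ
  have h1 : σ ∈ lowerGroup p K F u ↔
      displacement p K F ϖ σ ≤ spectralNorm ℚ_[p] F ϖ ^ ⌈u + 1⌉₊ := by
    rw [mem_lowerGroup_iff]
    simp only [mem_maxIdeal_pow_iff hϖ, coe_gal_smul_sub]
    refine ⟨fun h ↦ h ϖ, fun h x ↦ le_trans ?_ h⟩
    exact spectralNorm_sub_le_of_fixed (T := ⊥) bot_le hϖ (by simp) (by simp) hσ (by simp) x.2
  rw [h1]
  by_cases h0 : σ • ϖ - ϖ = 0
  · have : displacement p K F ϖ σ = 0 := by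
      rw [displacement, ← coe_gal_smul_sub, h0]
      exact spectralNorm_zero
    rw [this]
    exact iff_of_true (by positivity) (by positivity)
  · obtain ⟨n, hn⟩ := exists_spectralNorm_eq_pow hϖ h0
    rw [coe_gal_smul_sub] at hn
    rw [displacement, hn, ← Real.rpow_natCast _ n,
      Real.rpow_le_rpow_left_iff_of_base_lt_one hpos hlt, Real.rpow_natCast,
      pow_le_pow_iff_right_of_lt_one₀ hpos hlt, Nat.ceil_le]

open Classical in
theorem inv_relIndex_lowerGroup [IsGalois K F] {ϖ : integers p F} (hϖ : Irreducible ϖ) (t : ℝ) :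
    (((lowerGroup p K F t).relIndex (lowerGroup p K F 0) : ℕ) : ℝ)⁻¹
      = (Fintype.card (lowerGroup p K F 0) : ℝ)⁻¹ * ∑ g : lowerGroup p K F 0,
        if displacement p K F ϖ g ≤ spectralNorm ℚ_[p] F ϖ ^ (t + 1) then 1 else 0 := by
  have h := Subgroup.card_mul_index ((lowerGroup p K F t).subgroupOf (lowerGroup p K F 0))
  have hidx : 0 < ((lowerGroup p K F t).subgroupOf (lowerGroup p K F 0)).index :=
    Nat.pos_of_ne_zero Subgroup.FiniteIndex.index_ne_zero
  have hcard : Nat.card ((lowerGroup p K F t).subgroupOf (lowerGroup p K F 0))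
      = ∑ g : lowerGroup p K F 0,
        if displacement p K F ϖ g ≤ spectralNorm ℚ_[p] F ϖ ^ (t + 1) then 1 else 0 := by
    rw [Finset.sum_boole, Nat.cast_id, Nat.card_eq_fintype_card, Fintype.card_subtype]
    congr 1
    ext g
    simp only [Finset.mem_filter, Finset.mem_univ, true_and]
    exact mem_lowerGroup_iff_displacement_le hϖ g.2 t
  have hcard' : (Nat.card ((lowerGroup p K F t).subgroupOf (lowerGroup p K F 0)) : ℝ)
      = ∑ g : lowerGroup p K F 0,
        if displacement p K F ϖ g ≤ spectralNorm ℚ_[p] F ϖ ^ (t + 1) then 1 else 0 := by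
    rw [hcard]; push_cast; rfl
  rw [← hcard', Subgroup.relIndex, ← Nat.card_eq_fintype_card, ← h]
  have h1 : (Nat.card ((lowerGroup p K F t).subgroupOf (lowerGroup p K F 0)) : ℝ) ≠ 0 := by
    exact_mod_cast Nat.card_pos.ne'
  have h2 : (((lowerGroup p K F t).subgroupOf (lowerGroup p K F 0)).index : ℝ) ≠ 0 := by
    exact_mod_cast hidx.ne'
  push_cast
  field_simp

open Classical in
/-- The contribution of an element with index `i` to the Herbrand function at `u` is
`min (i - 1) u`. -/
theorem exists_integral_ite_displacement {q d u : ℝ} (hq0 : 0 < q) (hq1 : q < 1) (hu : 0 ≤ u)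
    (hd0 : 0 ≤ d) (hd : d ≤ q) :
    IntervalIntegrable (fun t : ℝ ↦ if d ≤ q ^ (t + 1) then (1 : ℝ) else 0)
        MeasureTheory.volume 0 u ∧
      q ^ ((∫ t in (0 : ℝ)..u, if d ≤ q ^ (t + 1) then (1 : ℝ) else 0) + 1)
        = max d (q ^ (u + 1)) := by
  have hanti : Antitone fun t : ℝ ↦ q ^ (t + 1) := fun s t hst ↦
    Real.rpow_le_rpow_of_exponent_ge hq0 hq1.le (by linarith)
  constructor
  · refine Antitone.intervalIntegrable fun s t hst ↦ ?_
    by_cases h : d ≤ q ^ (t + 1)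
    · simp [h, h.trans (hanti hst)]
    · simp only [h, if_false]
      split_ifs <;> norm_num
  · rcases le_or_gt d (q ^ (u + 1)) with h | h
    · rw [intervalIntegral.integral_congr (g := fun _ ↦ (1 : ℝ)), max_eq_right h]
      · simp
      · intro t ht
        rw [Set.uIcc_of_le hu] at ht
        simp [h.trans (hanti ht.2)]
    · have hdpos : 0 < d := (Real.rpow_pos_of_pos hq0 _).trans h
      obtain ⟨a, rfl⟩ : ∃ a : ℝ, q ^ a = d :=
        ⟨Real.logb q d, Real.rpow_logb hq0 hq1.ne hdpos⟩
      rw [Real.rpow_lt_rpow_left_iff_of_base_lt_one hq0 hq1] at h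
      have ha : 1 ≤ a := by
        rw [← Real.rpow_le_rpow_left_iff_of_base_lt_one hq0 hq1, Real.rpow_one]
        exact hd
      have hind : (fun t : ℝ ↦ if q ^ a ≤ q ^ (t + 1) then (1 : ℝ) else 0)
          = Set.indicator {t | t ≤ a - 1} fun _ ↦ 1 := by
        ext t
        simp only [Real.rpow_le_rpow_left_iff_of_base_lt_one hq0 hq1, Set.indicator_apply,
          Set.mem_ofPred_eq, le_sub_iff_add_le]
      rw [hind, intervalIntegral.integral_indicator ⟨by linarith, by linarith⟩, max_eq_left]
      · simp
      · exact Real.rpow_le_rpow_of_exponent_ge hq0 hq1.le h.le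

/-- The relation between `herbrandProd` and the Herbrand function `φ`: with `N = |G₀|`, one has
`‖ϖ‖ ^ (N * (φ u + 1)) = ∏ max ‖g ϖ - ϖ‖ (‖ϖ‖ ^ (u + 1))`. -/
theorem rpow_herbrand_eq_herbrandProd [IsGalois K F] {ϖ : integers p F} (hϖ : Irreducible ϖ)
    {u : ℝ} (hu : 0 ≤ u) :
    spectralNorm ℚ_[p] F ϖ ^ (Fintype.card (lowerGroup p K F 0) * (herbrand p K F u + 1))
      = herbrandProd p K F ϖ (spectralNorm ℚ_[p] F ϖ ^ (u + 1)) := by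
  classical
  have hpos := spectralNorm_pos_of_irreducible hϖ
  have hlt := spectralNorm_lt_one_of_irreducible hϖ
  have key (g : lowerGroup p K F 0) := exists_integral_ite_displacement hpos hlt hu
    (displacement_nonneg ϖ g.1) (displacement_le hϖ g.2)
  have hcard : (Fintype.card (lowerGroup p K F 0) : ℝ) ≠ 0 := by
    exact_mod_cast Fintype.card_ne_zero
  rw [herbrand]
  simp only [inv_relIndex_lowerGroup hϖ]
  rw [intervalIntegral.integral_const_mul,
    intervalIntegral.integral_finsetSum fun g _ ↦ (key g).1, mul_add, mul_inv_cancel_left₀ hcard,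
    mul_one, herbrandProd, ← Finset.prod_congr rfl fun g _ ↦ (key g).2,
    ← Real.rpow_sum_of_pos hpos, Finset.sum_add_distrib]
  simp

theorem exists_herbrand_eq [IsGalois K F] {v : ℝ} (hv : 0 ≤ v) :
    ∃ u, 0 ≤ u ∧ herbrand p K F u = v := by
  obtain ⟨ϖ, hϖ⟩ := IsDiscreteValuationRing.exists_irreducible (integers p F)
  have hpos := spectralNorm_pos_of_irreducible hϖ
  have hlt := spectralNorm_lt_one_of_irreducible hϖ
  set q := spectralNorm ℚ_[p] F ϖ
  set N := Fintype.card (lowerGroup p K F 0)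
  have hcont : Continuous (herbrandProd p K F ϖ) := by
    unfold herbrandProd
    fun_prop
  have h0 : herbrandProd p K F ϖ 0 = 0 :=
    Finset.prod_eq_zero (Finset.mem_univ 1) (by simp [displacement_one])
  have hq : herbrandProd p K F ϖ q = q ^ N := by
    rw [herbrandProd, Finset.prod_congr rfl fun g _ ↦ max_eq_right (displacement_le hϖ g.2)]
    simp [N, q]
  have hpos' : 0 < q ^ ((N : ℝ) * (v + 1)) := Real.rpow_pos_of_pos hpos _
  obtain ⟨s, hs, hsv⟩ := intermediate_value_Icc hpos.le hcont.continuousOn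
    (show q ^ ((N : ℝ) * (v + 1)) ∈ Set.Icc (herbrandProd p K F ϖ 0) (herbrandProd p K F ϖ q) by
      rw [h0, hq]
      refine ⟨hpos'.le, ?_⟩
      rw [← Real.rpow_natCast]
      exact Real.rpow_le_rpow_of_exponent_ge hpos hlt.le
        (le_mul_of_one_le_right N.cast_nonneg (by linarith)))
  have hs0 : 0 < s := by
    refine lt_of_le_of_ne hs.1 ?_
    rintro rfl
    rw [h0] at hsv
    exact hpos'.ne hsv
  obtain ⟨a, rfl⟩ : ∃ a : ℝ, q ^ a = s := ⟨Real.logb q s, Real.rpow_logb hpos hlt.ne hs0⟩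
  have ha : 1 ≤ a := by
    rw [← Real.rpow_le_rpow_left_iff_of_base_lt_one hpos hlt, Real.rpow_one]
    exact hs.2
  refine ⟨a - 1, by linarith, ?_⟩
  have h := rpow_herbrand_eq_herbrandProd (K := K) hϖ (u := a - 1) (by linarith)
  rw [sub_add_cancel, hsv] at h
  have hN : (N : ℝ) ≠ 0 := by exact_mod_cast Fintype.card_ne_zero
  have h2 := (Real.rpow_right_inj hpos hlt.ne).mp h
  have h3 := mul_left_cancel₀ hN h2
  linarith

theorem herbrandInv_spec [IsGalois K F] {v : ℝ} (hv : 0 < v) :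
    0 ≤ herbrandInv p K F v ∧ herbrand p K F (herbrandInv p K F v) = v := by
  obtain ⟨u, hu, huv⟩ := exists_herbrand_eq (p := p) (K := K) (F := F) hv.le
  have hex : ∃ u ∈ Set.Ici (-1 : ℝ), herbrand p K F u = v :=
    ⟨u, Set.mem_Ici.mpr (by linarith), huv⟩
  have heq : herbrand p K F (herbrandInv p K F v) = v := Function.invFunOn_eq hex
  refine ⟨?_, heq⟩
  by_contra! h
  -- The Herbrand function is not positive at negative arguments, its integrand being nonnegative.
  have h1 : herbrand p K F (herbrandInv p K F v) ≤ 0 := by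
    rw [herbrand, intervalIntegral.integral_symm]
    refine neg_nonpos.mpr (intervalIntegral.integral_nonneg h.le fun t _ ↦ ?_)
    positivity
  linarith

/-- The upper numbering in terms of a uniformizer. -/
theorem mem_upperGroup_iff [IsGalois K F] {π : integers p K} (hπ : Irreducible π)
    {ϖ : integers p F} (hϖ : Irreducible ϖ) {v : ℝ} (hv : 0 < v) {σ : Gal(F/K)} :
    σ ∈ upperGroup p K F v ↔ σ ∈ lowerGroup p K F 0 ∧
      herbrandProd p K F ϖ (displacement p K F ϖ σ) ≤ spectralNorm ℚ_[p] K π ^ (v + 1) := by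
  obtain ⟨hu, huv⟩ := herbrandInv_spec (p := p) (K := K) (F := F) hv
  have hpos := spectralNorm_pos_of_irreducible hϖ
  have h := rpow_herbrand_eq_herbrandProd (K := K) hϖ hu
  rw [huv] at h
  have h2 : spectralNorm ℚ_[p] K π ^ (v + 1) = herbrandProd p K F ϖ
      (spectralNorm ℚ_[p] F ϖ ^ (herbrandInv p K F v + 1)) := by
    rw [← h, spectralNorm_eq_pow_card_lowerGroup (F := F) hπ hϖ, ← Real.rpow_natCast,
      ← Real.rpow_mul hpos.le, Nat.card_eq_fintype_card]
  rw [h2, herbrandProd_le_iff ϖ (displacement_nonneg _ _) (Real.rpow_pos_of_pos hpos _),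
    upperGroup]
  constructor
  · intro hσ
    have h0 := lowerGroup_le_zero hu hσ
    exact ⟨h0, (mem_lowerGroup_iff_displacement_le hϖ h0 _).mp hσ⟩
  · rintro ⟨h0, hσ⟩
    exact (mem_lowerGroup_iff_displacement_le hϖ h0 _).mpr hσ

end Herbrand

end LocalRamification

/-! ### Compatibility of the upper numbering with quotients -/

namespace LocalRamification

open IsLocalRing

theorem prod_le_prod_of_injective {α β : Type*} [Fintype α] [Fintype β] {i : α → β}
    (hi : Function.Injective i) {f : β → ℝ} (h0 : ∀ b, 0 ≤ f b) (h1 : ∀ b, f b ≤ 1) :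
    ∏ b, f b ≤ ∏ a, f (i a) := by
  classical
  rw [← Finset.prod_image (f := f) (s := Finset.univ) (g := i) fun x _ y _ h ↦ hi h,
    ← Finset.prod_compl_mul_prod (Finset.univ.image i)]
  exact mul_le_of_le_one_left (Finset.prod_nonneg fun b _ ↦ h0 b)
    (Finset.prod_le_one (fun b _ ↦ h0 b) fun b _ ↦ h1 b)

section FiniteLevel

variable {p : ℕ} [Fact p.Prime] {K F : Type*} [Field K] [Field F] [Algebra ℚ_[p] K]
  [Algebra ℚ_[p] F] [Algebra K F] [IsScalarTower ℚ_[p] K F]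
  [FiniteDimensional ℚ_[p] K] [FiniteDimensional ℚ_[p] F] [FiniteDimensional K F]

theorem card_map_subtype {G : Type*} [Group G] {H : Subgroup G} (S : Subgroup H) [Fintype S] :
    Nat.card (S.map H.subtype) = Fintype.card S := by
  rw [Nat.card_congr (S.equivMapOfInjective H.subtype H.subtype_injective).toEquiv.symm,
    Nat.card_eq_fintype_card]

/-- Let `S` be a subgroup of the inertia group and `c` a uniformizer of its fixed field. The
product of the displacements of `ϖ` over a coset of `S` is at most the displacement of `c`. -/
theorem prod_displacement_le [IsGalois K F] {ϖ : integers p F} (hϖ : Irreducible ϖ)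
    (S : Subgroup (lowerGroup p K F 0)) [Fintype S] {c : F} (hcS : ∀ τ ∈ S, τ • c = c)
    (hc : spectralNorm ℚ_[p] F c = spectralNorm ℚ_[p] F ϖ ^ Fintype.card S)
    (σ : lowerGroup p K F 0) :
    ∏ τ : S, displacement p K F ϖ (σ * τ : lowerGroup p K F 0)
      ≤ spectralNorm ℚ_[p] F (σ • c - c) := by
  let := spectralNorm.normedField ℚ_[p] F
  have : IsUltrametricDist F :=
    IsUltrametricDist.isUltrametricDist_of_isNonarchimedean_norm isNonarchimedean_spectralNorm
  refine prod_norm_smul_sub_le S (fun g x ↦ spectralNorm_gal_apply p g.1 x) ϖ.2 σ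
    fun x hxS hx ↦ ?_
  refine spectralNorm_sub_le_of_fixed (T := S.map (lowerGroup p K F 0).subtype)
    (Subgroup.map_subtype_le S) hϖ ?_ (by rw [card_map_subtype, hc]) σ.2 ?_ hx
  · rintro _ ⟨τ, hτ, rfl⟩
    exact hcS τ hτ
  · rintro _ ⟨τ, hτ, rfl⟩
    exact hxS τ hτ

/-- Let `S` be a normal subgroup of the inertia group. The displacement of an integral element
of its fixed field is at most the product of the displacements of `ϖ` over the coset. -/
theorem le_prod_displacement [IsGalois K F] {ϖ : integers p F} (hϖ : Irreducible ϖ)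
    (S : Subgroup (lowerGroup p K F 0)) [S.Normal] [Fintype S] {x : F}
    (hxS : ∀ τ ∈ S, τ • x = x) (hx : spectralNorm ℚ_[p] F x ≤ 1) (σ : lowerGroup p K F 0) :
    spectralNorm ℚ_[p] F (σ • x - x)
      ≤ ∏ τ : S, displacement p K F ϖ (σ * τ : lowerGroup p K F 0) := by
  have hle := Subgroup.map_subtype_le S
  let := spectralNorm.normedField ℚ_[p] F
  have : IsUltrametricDist F :=
    IsUltrametricDist.isUltrametricDist_of_isNonarchimedean_norm isNonarchimedean_spectralNorm
  -- The norm `∏ τ ∈ S, τ ϖ` of `ϖ` is a uniformizer of the fixed field of `S`.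
  have h0 : (ϖ : F) ≠ 0 := norm_pos_iff.mp (spectralNorm_pos_of_irreducible hϖ)
  have key := norm_smul_prod_sub_le S h0 (spectralNorm_lt_one_of_irreducible hϖ)
    (fun y hy hyS ↦ by
      rw [← card_map_subtype]
      refine exists_spectralNorm_eq_zpow_of_fixed hle hϖ hy ?_
      rintro _ ⟨τ, hτ, rfl⟩
      exact hyS τ hτ) σ
  refine le_trans ?_ key
  refine spectralNorm_sub_le_of_fixed hle hϖ (c := ∏ τ : S, τ • (ϖ : F)) ?_ ?_ σ.2 ?_ hx
  · rintro _ ⟨τ, hτ, rfl⟩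
    change (⟨τ, hτ⟩ : S) • (∏ τ : S, τ • (ϖ : F)) = _
    rw [Finset.smul_prod']
    refine Fintype.prod_equiv (Equiv.mulLeft ⟨τ, hτ⟩) _ _ fun y ↦ ?_
    rw [Equiv.coe_mulLeft, mul_smul]
  · change ‖∏ τ : S, τ • (ϖ : F)‖ = ‖(ϖ : F)‖ ^ _
    rw [norm_prod, card_map_subtype, Finset.prod_congr rfl
      fun (τ : S) _ ↦ show ‖τ • (ϖ : F)‖ = ‖(ϖ : F)‖ from spectralNorm_gal_apply p τ.1.1 _]
    simp
  · rintro _ ⟨τ, hτ, rfl⟩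
    exact hxS τ hτ

variable (L : Type*) [Field L] [Algebra ℚ_[p] L] [Algebra K L] [IsScalarTower ℚ_[p] K L]
  [Algebra L F] [IsScalarTower K L F] [IsScalarTower ℚ_[p] L F] [FiniteDimensional ℚ_[p] L]
  [FiniteDimensional K L]

omit [Algebra ℚ_[p] K] [IsScalarTower ℚ_[p] K F] [FiniteDimensional ℚ_[p] K]
  [FiniteDimensional ℚ_[p] F] [FiniteDimensional K F] [IsScalarTower ℚ_[p] K L]
  [FiniteDimensional ℚ_[p] L] [FiniteDimensional K L] in
theorem spectralNorm_restrictNormalHom_sub [Normal K L] (σ : Gal(F/K)) (x : L) :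
    spectralNorm ℚ_[p] L (AlgEquiv.restrictNormalHom L σ x - x)
      = spectralNorm ℚ_[p] F (σ (algebraMap L F x) - algebraMap L F x) := by
  rw [spectralNorm.eq_of_tower (L := F), map_sub]
  congr 2
  exact AlgEquiv.restrictNormal_commutes σ L x

omit [FiniteDimensional ℚ_[p] K] [FiniteDimensional K F] [FiniteDimensional K L] in
theorem restrictNormalHom_mem_lowerGroup_zero [Normal K L] {σ : Gal(F/K)}
    (hσ : σ ∈ lowerGroup p K F 0) : AlgEquiv.restrictNormalHom L σ ∈ lowerGroup p K L 0 := by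
  rw [mem_lowerGroup_zero] at hσ ⊢
  intro x hx
  rw [spectralNorm_restrictNormalHom_sub]
  rw [spectralNorm.eq_of_tower (L := F)] at hx
  exact hσ _ hx

/-- Restriction to a Galois subextension respects the upper numbering (Herbrand). -/
theorem restrictNormalHom_mem_upperGroup [IsGalois K F] [IsGalois K L] {v : ℝ} (hv : 0 < v)
    {σ : Gal(F/K)} (hσ : σ ∈ upperGroup p K F v) :
    AlgEquiv.restrictNormalHom L σ ∈ upperGroup p K L v := by
  classical
  obtain ⟨π, hπ⟩ := IsDiscreteValuationRing.exists_irreducible (integers p K)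
  obtain ⟨ϖ, hϖ⟩ := IsDiscreteValuationRing.exists_irreducible (integers p F)
  obtain ⟨ϖL, hϖL⟩ := IsDiscreteValuationRing.exists_irreducible (integers p L)
  rw [mem_upperGroup_iff hπ hϖ hv] at hσ
  obtain ⟨hσ0, hσ⟩ := hσ
  rw [mem_upperGroup_iff hπ hϖL hv]
  refine ⟨restrictNormalHom_mem_lowerGroup_zero L hσ0, le_trans ?_ hσ⟩
  let f : lowerGroup p K F 0 →* Gal(L/K) :=
    (AlgEquiv.restrictNormalHom L).comp (lowerGroup p K F 0).subtype
  let S := f.ker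
  have : Fintype S := Fintype.ofFinite _
  have : Fintype (lowerGroup p K F 0 ⧸ S) := Fintype.ofFinite _
  have hS : ∀ τ ∈ S, ∀ x : L, τ • algebraMap L F x = algebraMap L F x := fun τ hτ x ↦ by
    have h := AlgEquiv.restrictNormal_commutes τ.1 L x
    rw [show τ.1.restrictNormal L = 1 from hτ] at h
    exact h.symm
  have hint : spectralNorm ℚ_[p] F (algebraMap L F ϖL) ≤ 1 :=
    (spectralNorm.eq_of_tower (L := F) (ϖL : L)).symm.trans_le ϖL.2
  have hD (g : lowerGroup p K F 0) : displacement p K L ϖL (f g)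
      ≤ ∏ τ : S, displacement p K F ϖ (g * τ : lowerGroup p K F 0) := by
    refine le_of_eq_of_le (spectralNorm_restrictNormalHom_sub L g.1 (ϖL : L)) ?_
    exact le_prod_displacement hϖ S (fun τ hτ ↦ hS τ hτ _) hint g
  have key := prod_quotient_max_le_prod_max (S := S)
    (d := fun g ↦ displacement p K F ϖ (g : Gal(F/K)))
    (D := fun g ↦ displacement p K L ϖL (f g)) (fun _ ↦ displacement_nonneg _ _)
    (fun _ _ ↦ displacement_mul _ _ _) (fun _ ↦ displacement_inv _ _)
    (fun g τ hτ ↦ by rw [map_mul, show f τ = 1 from hτ, mul_one]) hD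
    (fun _ ↦ displacement_nonneg _ _) ⟨σ, hσ0⟩ Quotient.out Quotient.out_eq'
  refine le_trans ?_ key
  have hf (g : lowerGroup p K F 0) : f g ∈ lowerGroup p K L 0 :=
    restrictNormalHom_mem_lowerGroup_zero L g.2
  let i : lowerGroup p K F 0 ⧸ S → lowerGroup p K L 0 := fun q ↦ ⟨f q.out, hf _⟩
  have hi : Function.Injective i := by
    intro q q' h
    have h1 : f q.out = f q'.out := congrArg Subtype.val h
    rw [← Quotient.out_eq' q, ← Quotient.out_eq' q']
    refine QuotientGroup.eq.mpr ?_
    change f _ = 1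
    rw [map_mul, map_inv, h1, inv_mul_cancel]
  have hle (g : lowerGroup p K L 0) : displacement p K L ϖL g ≤ 1 :=
    (displacement_le hϖL g.2).trans ϖL.2
  -- The elements of the inertia group of `L` outside the image contribute factors at most `1`.
  exact prod_le_prod_of_injective hi (fun _ ↦ le_max_of_le_left (displacement_nonneg _ _))
    fun g ↦ max_le (hle g) (hle ⟨f ⟨σ, hσ0⟩, hf _⟩)

end FiniteLevel

end LocalRamification

/-! ### Roots of unity and `p`-power roots of a uniformizer -/

/-- Roots of unity `ξ` of order dividing `p ^ n` satisfy `‖ξ - 1‖ ^ (p ^ n) ≤ ‖p‖ ^ (p / (p - 1))`;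
here `b` stands for `‖p‖ ^ (1 / (p - 1))`. -/
theorem norm_sub_one_pow_le_of_pow_eq_one {F : Type*} [NormedField F] [IsUltrametricDist F]
    {p : ℕ} (hp : p.Prime) {b : ℝ} (hb0 : 0 ≤ b) (hb1 : b ≤ 1) (hb : ‖(p : F)‖ = b ^ (p - 1))
    (n : ℕ) {ξ : F} (hξ : ξ ^ p ^ n = 1) : ‖ξ - 1‖ ^ p ^ n ≤ b ^ p := by
  induction n generalizing ξ with
  | zero =>
    rw [pow_zero, pow_one] at hξ
    simp [hξ, pow_nonneg hb0]
  | succ n ih =>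
    have hξ1 : ‖ξ‖ = 1 := by
      have h := congrArg norm hξ
      rw [norm_pow, norm_one] at h
      exact (pow_eq_one_iff_of_nonneg (norm_nonneg _) (pow_ne_zero _ hp.ne_zero)).mp h
    have hx : ‖ξ - 1‖ ≤ 1 :=
      (norm_sub_le_max' ξ 1).trans (max_le hξ1.le norm_one.le)
    obtain ⟨r, hr, h⟩ := exists_pow_prime_sub_pow_eq hp hx norm_one.le
    rw [add_sub_cancel, one_pow, mul_one] at h
    have hle : ‖ξ - 1‖ ^ p ≤ max ‖ξ ^ p - 1‖ (‖(p : F)‖ * ‖ξ - 1‖) := by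
      rw [← norm_pow, eq_sub_of_add_eq h.symm]
      refine (norm_sub_le_max' _ _).trans (max_le_max le_rfl ?_)
      rw [norm_mul, norm_mul]
      exact mul_le_of_le_one_right (by positivity) hr
    rw [pow_succ' p n, pow_mul]
    rcases le_max_iff.mp hle with h1 | h1
    · refine (pow_le_pow_left₀ (by positivity) h1 _).trans (ih ?_)
      rw [← pow_mul, ← pow_succ', hξ]
    · have hxb : ‖ξ - 1‖ ≤ b := by
        rcases (norm_nonneg (ξ - 1)).eq_or_lt with h0 | h0
        · rw [← h0]; exact hb0
        · rw [hb, ← pow_sub_one_mul hp.ne_zero] at h1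
          exact le_of_pow_le_pow_left₀ (Nat.sub_ne_zero_of_lt hp.one_lt) hb0
            (le_of_mul_le_mul_right h1 h0)
      rw [← pow_mul]
      refine (pow_le_pow_left₀ (norm_nonneg _) hxb _).trans (pow_le_pow_of_le_one hb0 hb1 ?_)
      exact Nat.le_mul_of_pos_right p (pow_pos hp.pos n)

namespace LocalRamification

open IsLocalRing

section Transitivity

variable {p : ℕ} [Fact p.Prime] {K : Type*} [Field K] [Algebra ℚ_[p] K]
  [FiniteDimensional ℚ_[p] K]

theorem spectralNorm_prime_eq_pow {π : integers p K} (hπ : Irreducible π) :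
    spectralNorm ℚ_[p] K (p : K) = spectralNorm ℚ_[p] K π ^ absRamificationIdx p K := by
  have hp0 : (p : integers p K) ≠ 0 := by
    intro h
    have h2 : algebraMap ℚ_[p] K p = 0 := by
      rw [map_natCast]; exact congrArg Subtype.val h
    rw [map_eq_zero_iff _ (algebraMap ℚ_[p] K).injective, Nat.cast_eq_zero] at h2
    exact (Fact.out : p.Prime).ne_zero h2
  obtain ⟨n, hn⟩ := exists_spectralNorm_eq_pow hπ hp0
  have hset : {m : ℕ | (p : integers p K) ∈ maxIdeal p K ^ m} = Set.Iic n := by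
    ext m
    rw [Set.mem_ofPred_eq, mem_maxIdeal_pow_iff hπ, hn, Set.mem_Iic]
    exact pow_le_pow_iff_right_of_lt_one₀ (spectralNorm_pos_of_irreducible hπ)
      (spectralNorm_lt_one_of_irreducible hπ)
  rw [absRamificationIdx, hset, csSup_Iic]
  exact hn

theorem eStar_pos : 0 < eStar p K := by
  obtain ⟨π, hπ⟩ := IsDiscreteValuationRing.exists_irreducible (integers p K)
  have h := spectralNorm_prime_eq_pow hπ
  have hp : (1 : ℝ) < p := by exact_mod_cast (Fact.out : p.Prime).one_lt
  have he : absRamificationIdx p K ≠ 0 := by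
    intro h0
    rw [h0, pow_zero] at h
    exact (spectralNorm_natCast_prime_lt_one p K).ne h
  have he' : (0 : ℝ) < absRamificationIdx p K := by exact_mod_cast Nat.pos_of_ne_zero he
  exact div_pos (mul_pos he' (by linarith)) (by linarith)

theorem rpow_eStar_add_one {π : integers p K} (hπ : Irreducible π) :
    spectralNorm ℚ_[p] K π ^ (eStar p K + 1)
      = (spectralNorm ℚ_[p] K (p : K) ^ (1 / ((p : ℝ) - 1))) ^ p * spectralNorm ℚ_[p] K π := by
  have hpos := spectralNorm_pos_of_irreducible hπ
  rw [Real.rpow_add hpos, Real.rpow_one, spectralNorm_prime_eq_pow hπ, ← Real.rpow_natCast _ p,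
    ← Real.rpow_mul (by positivity), ← Real.rpow_natCast, ← Real.rpow_mul hpos.le, eStar]
  congr 2
  ring

variable {F : Type*} [Field F] [Algebra ℚ_[p] F] [Algebra K F] [IsScalarTower ℚ_[p] K F]
  [FiniteDimensional ℚ_[p] F] [FiniteDimensional K F]

omit [FiniteDimensional K F] in
/-- Two roots of `X ^ (p ^ n) - π` are close to each other. -/
theorem spectralNorm_sub_pow_le {π : integers p K} (hπ : Irreducible π) {n : ℕ} {r s : F}
    (hr : r ^ p ^ n = algebraMap K F π) (hs : s ^ p ^ n = algebraMap K F π) :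
    spectralNorm ℚ_[p] F (s - r) ^ p ^ n ≤ spectralNorm ℚ_[p] K π ^ (eStar p K + 1) := by
  have hπ0 : (π : K) ≠ 0 := fun h ↦ hπ.ne_zero (Subtype.ext h)
  have hr0 : r ≠ 0 := by
    rintro rfl
    rw [zero_pow (pow_ne_zero _ (Fact.out : p.Prime).ne_zero)] at hr
    exact (map_ne_zero_iff _ (algebraMap K F).injective).mpr hπ0 hr.symm
  have hp : (1 : ℝ) < p := by exact_mod_cast (Fact.out : p.Prime).one_lt
  rw [rpow_eStar_add_one hπ, spectralNorm.eq_of_tower (E := K) (L := F),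
    spectralNorm.eq_of_tower (E := K) (L := F) (π : K), map_natCast]
  let := spectralNorm.normedField ℚ_[p] F
  have : IsUltrametricDist F :=
    IsUltrametricDist.isUltrametricDist_of_isNonarchimedean_norm isNonarchimedean_spectralNorm
  change ‖s - r‖ ^ p ^ n ≤ (‖(p : F)‖ ^ (1 / ((p : ℝ) - 1))) ^ p * ‖algebraMap K F π‖
  have hpF : ‖(p : F)‖ ≤ 1 := (spectralNorm_natCast_prime_lt_one p F).le
  have hξ : (s / r) ^ p ^ n = 1 := by
    rw [div_pow, hr, hs, div_self ((map_ne_zero_iff _ (algebraMap K F).injective).mpr hπ0)]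
  have key := norm_sub_one_pow_le_of_pow_eq_one (F := F) (b := ‖(p : F)‖ ^ (1 / ((p : ℝ) - 1)))
    (Fact.out : p.Prime) (by positivity)
    (Real.rpow_le_one (norm_nonneg _) hpF (by rw [one_div, inv_nonneg]; linarith))
    (by
      rw [← Real.rpow_natCast, ← Real.rpow_mul (norm_nonneg _),
        Nat.cast_sub (Fact.out : p.Prime).one_le, Nat.cast_one, one_div,
        inv_mul_cancel₀ (by linarith), Real.rpow_one]) n hξ
  have hsr : s - r = (s / r - 1) * r := by field_simp
  rw [hsr, norm_mul, mul_pow, ← norm_pow r, hr]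
  gcongr

/-- The stabilizer in the inertia group of a `p ^ n`-th root `r` of a uniformizer has index `p ^ n`,
`r` is a uniformizer of its fixed field, and the inertia group permutes the roots transitively. The
index is a multiple of `p ^ n` by comparison of absolute values, and at most the number of roots. -/
theorem stabilizer_root [IsGalois K F] {π : integers p K} (hπ : Irreducible π)
    {ϖ : integers p F} (hϖ : Irreducible ϖ) {n : ℕ} {r : F}
    (hr : r ^ p ^ n = algebraMap K F π) :
    (MulAction.stabilizer (lowerGroup p K F 0) r).index = p ^ n ∧
      spectralNorm ℚ_[p] F r = spectralNorm ℚ_[p] F ϖ ^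
        Nat.card (MulAction.stabilizer (lowerGroup p K F 0) r) ∧
      ∀ s : F, s ^ p ^ n = algebraMap K F π → ∃ g : lowerGroup p K F 0, g • r = s := by
  classical
  have hpos := spectralNorm_pos_of_irreducible hϖ
  have hlt := spectralNorm_lt_one_of_irreducible hϖ
  have hpn : 0 < p ^ n := pow_pos (Fact.out : p.Prime).pos n
  have hπ0 : (π : K) ≠ 0 := fun h ↦ hπ.ne_zero (Subtype.ext h)
  have hr0 : r ≠ 0 := by
    rintro rfl
    rw [zero_pow hpn.ne'] at hr
    exact (map_ne_zero_iff _ (algebraMap K F).injective).mpr hπ0 hr.symm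
  set S := MulAction.stabilizer (lowerGroup p K F 0) r with hS
  obtain ⟨m, hm⟩ := exists_spectralNorm_eq_zpow_of_fixed
    (T := S.map (lowerGroup p K F 0).subtype) (Subgroup.map_subtype_le S) hϖ hr0 (by
      rintro _ ⟨τ, hτ, rfl⟩
      exact hτ)
  have : Fintype S := Fintype.ofFinite _
  rw [card_map_subtype, ← Nat.card_eq_fintype_card] at hm
  have hcard : (Nat.card S : ℤ) * m * p ^ n = Nat.card S * S.index := by
    have h1 : spectralNorm ℚ_[p] F ϖ ^ ((Nat.card S : ℤ) * m * p ^ n)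
        = spectralNorm ℚ_[p] F ϖ ^ ((Nat.card S * S.index : ℕ) : ℤ) := by
      rw [Subgroup.card_mul_index, zpow_natCast, ← spectralNorm_eq_pow_card_lowerGroup hπ hϖ,
        spectralNorm.eq_of_tower (E := K) (L := F), ← hr, zpow_mul, ← hm]
      let := spectralNorm.normedField ℚ_[p] F
      exact_mod_cast (norm_pow r (p ^ n)).symm
    have := zpow_right_injective₀ hpos hlt.ne h1
    exact_mod_cast this
  have hS0 : (Nat.card S : ℤ) ≠ 0 := by exact_mod_cast Nat.card_pos.ne'
  have hidx : m * p ^ n = S.index := by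
    rw [mul_assoc] at hcard
    exact mul_left_cancel₀ hS0 hcard
  set Z := (Polynomial.nthRoots (p ^ n) (algebraMap K F π)).toFinset with hZ
  have hmemZ (s : F) : s ∈ Z ↔ s ^ p ^ n = algebraMap K F π := by
    rw [hZ, Multiset.mem_toFinset, Polynomial.mem_nthRoots hpn]
  have hZcard : Z.card ≤ p ^ n :=
    (Multiset.toFinset_card_le _).trans (Polynomial.card_nthRoots _ _)
  have horb : MulAction.orbit (lowerGroup p K F 0) r ⊆ (Z : Set F) := by
    rintro _ ⟨g, rfl⟩
    rw [Finset.mem_coe, hmemZ]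
    change (g.1 r) ^ p ^ n = _
    rw [← map_pow, hr, AlgEquiv.commutes]
  have horbcard : (MulAction.orbit (lowerGroup p K F 0) r).ncard = S.index :=
    (MulAction.index_stabilizer _ _).symm
  have hidx_le : S.index ≤ Z.card := by
    rw [← horbcard, ← Set.ncard_coe_finset]
    exact Set.ncard_le_ncard horb Z.finite_toSet
  have hidx0 : 0 < S.index := Nat.pos_of_ne_zero Subgroup.FiniteIndex.index_ne_zero
  have hpnZ : (0 : ℤ) < p ^ n := by exact_mod_cast hpn
  have hm1 : m = 1 := by
    have h1 : m * (p : ℤ) ^ n ≤ 1 * p ^ n := by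
      rw [hidx, one_mul]; exact_mod_cast hidx_le.trans hZcard
    have h2 : 0 < m := by
      refine pos_of_mul_pos_left (b := (p : ℤ) ^ n) ?_ hpnZ.le
      rw [hidx]; exact_mod_cast hidx0
    have := le_of_mul_le_mul_right h1 hpnZ
    omega
  have hidx' : S.index = p ^ n := by
    rw [hm1, one_mul] at hidx
    exact_mod_cast hidx.symm
  refine ⟨hidx', ?_, fun s hs ↦ ?_⟩
  · rw [hm, hm1, mul_one, zpow_natCast]
  · have heq : MulAction.orbit (lowerGroup p K F 0) r = (Z : Set F) := by
      refine Set.eq_of_subset_of_ncard_le horb ?_ Z.finite_toSet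
      rw [Set.ncard_coe_finset, horbcard, hidx']
      exact hZcard
    have : s ∈ MulAction.orbit (lowerGroup p K F 0) r := by
      rw [heq, Finset.mem_coe, hmemZ]; exact hs
    exact this

/-- The ramification group at `e p / (p - 1)` acts transitively on the `p ^ n`-th roots of a
uniformizer. -/
theorem exists_mem_upperGroup_apply_eq [IsGalois K F] {π : integers p K} (hπ : Irreducible π)
    {n : ℕ} {r s : F} (hr : r ^ p ^ n = algebraMap K F π) (hs : s ^ p ^ n = algebraMap K F π) :
    ∃ g ∈ upperGroup p K F (eStar p K), g r = s := by
  classical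
  obtain ⟨ϖ, hϖ⟩ := IsDiscreteValuationRing.exists_irreducible (integers p F)
  obtain ⟨hidx, hnorm, htrans⟩ := stabilizer_root hπ hϖ hr
  set S := MulAction.stabilizer (lowerGroup p K F 0) r with hS
  have : Fintype S := Fintype.ofFinite _
  have : Fintype (lowerGroup p K F 0 ⧸ S) := Fintype.ofFinite _
  rw [Nat.card_eq_fintype_card] at hnorm
  obtain ⟨g₀, hg₀⟩ := htrans s hs
  obtain ⟨rep, hrep, hmin⟩ := exists_min_representative S
    fun g ↦ displacement p K F ϖ (g : Gal(F/K))
  set g := rep g₀ with hg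
  have hgr : g • r = s := by
    have h : g₀⁻¹ * g ∈ S := QuotientGroup.eq.mp (hrep g₀).symm
    rw [← hg₀, ← inv_smul_eq_iff, ← mul_smul]
    exact h
  refine ⟨g, (mem_upperGroup_iff hπ hϖ eStar_pos).mpr ⟨g.2, ?_⟩, hgr⟩
  set D : lowerGroup p K F 0 → ℝ := fun h ↦ spectralNorm ℚ_[p] F (h • r - r) with hDdef
  have key := prod_max_le_prod_quotient_max (S := S)
    (d := fun g ↦ displacement p K F ϖ (g : Gal(F/K))) (D := D)
    (fun _ ↦ displacement_nonneg _ _) (fun _ _ ↦ displacement_mul _ _ _)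
    (fun _ ↦ displacement_inv _ _) (fun h τ hτ ↦ by
      simp only [hDdef]
      rw [mul_smul, show τ • r = r from hτ])
    (fun h ↦ prod_displacement_le hϖ S (fun τ hτ ↦ hτ) hnorm h) (hmin g₀) rep hrep
  refine key.trans ?_
  have hD0 (h : lowerGroup p K F 0) : 0 ≤ D h := spectralNorm_nonneg _
  have hD (h : lowerGroup p K F 0) : D h ^ p ^ n ≤ spectralNorm ℚ_[p] K π ^ (eStar p K + 1) := by
    refine spectralNorm_sub_pow_le hπ hr ?_
    change (h.1 r) ^ p ^ n = _
    rw [← map_pow, hr, AlgEquiv.commutes]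
  have hC : 0 ≤ spectralNorm ℚ_[p] K π ^ (eStar p K + 1) :=
    Real.rpow_nonneg (spectralNorm_nonneg _) _
  -- All `p ^ n` factors have `p ^ n`-th power at most the claimed bound for the product.
  refine le_of_pow_le_pow_left₀ (pow_ne_zero n (Fact.out : p.Prime).ne_zero) hC ?_
  rw [← Finset.prod_pow]
  refine (Finset.prod_le_prod (g := fun _ ↦ spectralNorm ℚ_[p] K π ^ (eStar p K + 1))
    (fun q _ ↦ pow_nonneg (le_max_of_le_left (hD0 _)) _) fun q _ ↦ ?_).trans_eq ?_
  · rcases max_choice (D (rep q)) (D g) with h | h <;> rw [h] <;> exact hD _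
  · rw [Finset.prod_const, Finset.card_univ, ← Nat.card_eq_fintype_card]
    exact congrArg _ hidx

end Transitivity

end LocalRamification

/-! ### Passage to the absolute Galois group -/

namespace LocalRamification

section Absolute

variable {p : ℕ} [Fact p.Prime] {K : Type*} [Field K] [Algebra ℚ_[p] K]
  [FiniteDimensional ℚ_[p] K]

theorem restrictNormalHom_mem_upperGroup_of_le
    {L F : FiniteGaloisIntermediateField K (AlgebraicClosure K)} (h : L ≤ F) {v : ℝ} (hv : 0 < v)
    {g : Gal(AlgebraicClosure K/K)} (hg : AlgEquiv.restrictNormalHom F g ∈ upperGroup p K F v) :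
    AlgEquiv.restrictNormalHom L g ∈ upperGroup p K L v := by
  let : Algebra L F := (IntermediateField.inclusion h).toAlgebra
  have : IsScalarTower K L F := IsScalarTower.of_algebraMap_eq fun _ ↦ rfl
  have : IsScalarTower ℚ_[p] L F := IsScalarTower.of_algebraMap_eq fun _ ↦ rfl
  have : FiniteDimensional ℚ_[p] L := Module.Finite.trans K L
  have : FiniteDimensional ℚ_[p] F := Module.Finite.trans K F
  have key := restrictNormalHom_mem_upperGroup (F := F) L hv hg
  have heq : AlgEquiv.restrictNormalHom L (AlgEquiv.restrictNormalHom F g)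
      = AlgEquiv.restrictNormalHom L g := by
    ext x
    have h1 := AlgEquiv.restrictNormal_commutes (AlgEquiv.restrictNormalHom F g) L x
    have h2 := congrArg (fun y : F ↦ (y : AlgebraicClosure K)) h1
    have h3 := AlgEquiv.restrictNormal_commutes g F (algebraMap L F x)
    have h4 := AlgEquiv.restrictNormal_commutes g L x
    exact (h2.trans h3).trans h4.symm
  rwa [heq] at key

/-- Every automorphism agrees on a compatible system of `p`-power roots of a uniformizer with
an element of the absolute ramification group at `e p / (p - 1)`. -/
theorem exists_mem_absUpperGroup_apply_eq {π : integers p K} (hπ : Irreducible π)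
    (ϖ : ℕ → AlgebraicClosure K) (hϖ_zero : ϖ 0 = algebraMap K (AlgebraicClosure K) (π : K))
    (hϖ_succ : ∀ n, ϖ (n + 1) ^ p = ϖ n) (σ : Gal(AlgebraicClosure K/K)) :
    ∃ g ∈ absUpperGroup p K (eStar p K), ∀ n, g (ϖ n) = σ (ϖ n) := by
  have : CharZero K := charZero_of_injective_algebraMap (algebraMap ℚ_[p] K).injective
  have hpow (n k : ℕ) : ϖ (n + k) ^ p ^ k = ϖ n := by
    induction k with
    | zero => simp
    | succ k ih => rw [pow_succ', pow_mul, ← add_assoc, hϖ_succ, ih]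
  have hroot (n : ℕ) : ϖ n ^ p ^ n = algebraMap K (AlgebraicClosure K) (π : K) := by
    rw [← hϖ_zero, ← hpow 0 n, zero_add]
  let C (i : FiniteGaloisIntermediateField K (AlgebraicClosure K) × ℕ) :
      Set Gal(AlgebraicClosure K/K) :=
    {g | AlgEquiv.restrictNormalHom i.1 g ∈ upperGroup p K i.1 (eStar p K) ∧
      g (ϖ i.2) = σ (ϖ i.2)}
  have hclosed (i) : IsClosed (C i) := by
    refine IsClosed.inter ?_ ?_
    · exact (isClosed_discrete (upperGroup p K i.1 (eStar p K) : Set Gal(i.1/K))).preimage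
        (InfiniteGalois.restrictNormalHom_continuous i.1.toIntermediateField)
    · have h := Subgroup.isClosed_of_isOpen _ (stabilizer_isOpen_of_isIntegral (K := K) (ϖ i.2))
      have h2 := h.preimage (continuous_const_mul σ⁻¹)
      refine (congrArg IsClosed (Set.ext fun g ↦ ?_)).mp h2
      rw [Set.mem_preimage, SetLike.mem_coe, MulAction.mem_stabilizer_iff, mul_smul,
        inv_smul_eq_iff]
      rfl
  have hnonempty (i) : (C i).Nonempty := by
    obtain ⟨L, n⟩ := i
    let F := L ⊔ FiniteGaloisIntermediateField.adjoin K {ϖ n, σ (ϖ n)}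
    have hF : {ϖ n, σ (ϖ n)} ⊆ (F.toIntermediateField : Set (AlgebraicClosure K)) :=
      (FiniteGaloisIntermediateField.subset_adjoin K _).trans
        (le_sup_right : FiniteGaloisIntermediateField.adjoin K {ϖ n, σ (ϖ n)} ≤ F)
    have hr : ϖ n ∈ F.toIntermediateField := hF (Or.inl rfl)
    have hs : σ (ϖ n) ∈ F.toIntermediateField := hF (Or.inr rfl)
    have : FiniteDimensional ℚ_[p] F := Module.Finite.trans K F
    obtain ⟨g', hg', hgr⟩ := exists_mem_upperGroup_apply_eq (F := F) hπ (n := n) (r := ⟨ϖ n, hr⟩)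
      (s := ⟨σ (ϖ n), hs⟩) (Subtype.ext (hroot n)) (Subtype.ext (by
        change σ (ϖ n) ^ p ^ n = algebraMap K (AlgebraicClosure K) (π : K)
        rw [← map_pow, hroot, AlgEquiv.commutes]))
    obtain ⟨g, rfl⟩ := AlgEquiv.restrictNormalHom_surjective (AlgebraicClosure K) g'
    refine ⟨g, restrictNormalHom_mem_upperGroup_of_le le_sup_left eStar_pos hg', ?_⟩
    exact (AlgEquiv.restrictNormal_commutes g F ⟨ϖ n, hr⟩).symm.trans (congrArg Subtype.val hgr)
  have hdirected : Directed (· ⊇ ·) C := by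
    rintro ⟨L, n⟩ ⟨L', n'⟩
    have hval {n m : ℕ} (hnm : n ≤ m) {g : Gal(AlgebraicClosure K/K)} (hg : g (ϖ m) = σ (ϖ m)) :
        g (ϖ n) = σ (ϖ n) := by
      obtain ⟨k, rfl⟩ := Nat.exists_eq_add_of_le hnm
      rw [← hpow n k, map_pow, map_pow, hg]
    refine ⟨(L ⊔ L', max n n'), fun g hg ↦ ⟨?_, ?_⟩, fun g hg ↦ ⟨?_, ?_⟩⟩
    · exact restrictNormalHom_mem_upperGroup_of_le le_sup_left eStar_pos hg.1
    · exact hval (le_max_left n n') hg.2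
    · exact restrictNormalHom_mem_upperGroup_of_le le_sup_right eStar_pos hg.1
    · exact hval (le_max_right n n') hg.2
  obtain ⟨g, hg⟩ := IsCompact.nonempty_iInter_of_directed_nonempty_isCompact_isClosed C hdirected
    hnonempty (fun i ↦ (hclosed i).isCompact) hclosed
  rw [Set.mem_iInter] at hg
  refine ⟨g, ?_, fun n ↦ (hg (⊥, n)).2⟩
  rw [absUpperGroup, Subgroup.mem_iInf]
  exact fun L ↦ (hg (L, 0)).1

/-- The absolute Galois group is the product of its ramification group at `e p / (p - 1)` and the
subgroup fixing all `p`-power roots of a uniformizer in a compatible system. -/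
theorem exists_mul_eq_of_fixingSubgroup {π : integers p K} (hπ : Irreducible π)
    (ϖ : ℕ → AlgebraicClosure K) (hϖ_zero : ϖ 0 = algebraMap K (AlgebraicClosure K) (π : K))
    (hϖ_succ : ∀ n, ϖ (n + 1) ^ p = ϖ n) (σ : Gal(AlgebraicClosure K/K)) :
    ∃ g ∈ absUpperGroup p K (eStar p K),
      ∃ h ∈ (IntermediateField.adjoin K (Set.range ϖ)).fixingSubgroup, g * h = σ := by
  obtain ⟨g, hg, hgσ⟩ := exists_mem_absUpperGroup_apply_eq hπ ϖ hϖ_zero hϖ_succ σ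
  refine ⟨g, hg, g⁻¹ * σ, ?_, mul_inv_cancel_left g σ⟩
  rw [IntermediateField.mem_fixingSubgroup_iff]
  have hle : IntermediateField.adjoin K (Set.range ϖ)
      ≤ IntermediateField.fixedField (Subgroup.zpowers (g⁻¹ * σ)) := by
    rw [IntermediateField.adjoin_le_iff]
    rintro _ ⟨n, rfl⟩ ⟨τ, hτ⟩
    have h : Subgroup.zpowers (g⁻¹ * σ) ≤ MulAction.stabilizer Gal(AlgebraicClosure K/K) (ϖ n) := by
      rw [Subgroup.zpowers_le, MulAction.mem_stabilizer_iff, mul_smul, inv_smul_eq_iff]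
      exact (hgσ n).symm
    exact h hτ
  exact fun x hx ↦ hle hx ⟨g⁻¹ * σ, Subgroup.mem_zpowers _⟩

end Absolute

end LocalRamification

theorem lemma4 (p : ℕ) [Fact p.Prime] (K : Type*) [Field K] [Algebra ℚ_[p] K]
    [FiniteDimensional ℚ_[p] K]
    -- a uniformizer of `K` and a compatible system of `p`-power roots of it
    (π : LocalRamification.integers p K)
    (hπ : LocalRamification.maxIdeal p K = Ideal.span {π})
    (ϖ : ℕ → AlgebraicClosure K)
    (hϖ_zero : ϖ 0 = algebraMap K (AlgebraicClosure K) (π : K))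
    (hϖ_succ : ∀ n, ϖ (n + 1) ^ p = ϖ n)
    -- the field obtained by adjoining all these roots
    (Kinf : IntermediateField K (AlgebraicClosure K))
    (hKinf : Kinf = IntermediateField.adjoin K (Set.range ϖ))
    -- a finite coefficient field of characteristic `p`, and a representation
    (𝔽 : Type*) [Field 𝔽] [Finite 𝔽] [CharP 𝔽 p] [TopologicalSpace 𝔽] [DiscreteTopology 𝔽]
    (d : ℕ)
    (ρ : Gal(AlgebraicClosure K/K) →ₜ* Matrix.GeneralLinearGroup (Fin d) 𝔽)
    (hρ : ∀ g ∈ LocalRamification.absUpperGroup p K (LocalRamification.eStar p K), ρ g = 1) :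
    -- both Galois groups have the same image
    Kinf.fixingSubgroup.map ρ.toMonoidHom = ρ.toMonoidHom.range ∧
    -- `ρ` is determined by its restriction among the representations with this property
    (∀ ρ' : Gal(AlgebraicClosure K/K) →ₜ* Matrix.GeneralLinearGroup (Fin d) 𝔽,
      (∀ g ∈ LocalRamification.absUpperGroup p K (LocalRamification.eStar p K), ρ' g = 1) →
      (∀ g ∈ Kinf.fixingSubgroup, ρ' g = ρ g) → ρ' = ρ) ∧
    -- every isomorphism of the restrictions is an isomorphism of the representations
    (∀ ρ' : Gal(AlgebraicClosure K/K) →ₜ* Matrix.GeneralLinearGroup (Fin d) 𝔽,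
      (∀ g ∈ LocalRamification.absUpperGroup p K (LocalRamification.eStar p K), ρ' g = 1) →
      ∀ A : Matrix.GeneralLinearGroup (Fin d) 𝔽,
        (∀ g ∈ Kinf.fixingSubgroup, ρ' g = A * ρ g * A⁻¹) → ∀ g, ρ' g = A * ρ g * A⁻¹) := by
  have hirr : Irreducible π := (IsDiscreteValuationRing.irreducible_iff_uniformizer π).mpr hπ
  have hprod := LocalRamification.exists_mul_eq_of_fixingSubgroup hirr ϖ hϖ_zero hϖ_succ
  rw [← hKinf] at hprod
  have hconj (ρ' : Gal(AlgebraicClosure K/K) →ₜ* Matrix.GeneralLinearGroup (Fin d) 𝔽)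
      (hρ' : ∀ g ∈ LocalRamification.absUpperGroup p K (LocalRamification.eStar p K), ρ' g = 1)
      (A : Matrix.GeneralLinearGroup (Fin d) 𝔽)
      (hA : ∀ g ∈ Kinf.fixingSubgroup, ρ' g = A * ρ g * A⁻¹) (g) : ρ' g = A * ρ g * A⁻¹ := by
    obtain ⟨u, hu, h, hh, rfl⟩ := hprod g
    rw [map_mul, map_mul, hρ u hu, hρ' u hu, one_mul, one_mul, hA h hh]
  refine ⟨le_antisymm (Subgroup.map_le_range _ _) ?_, fun ρ' hρ' h ↦ ?_, hconj⟩
  · rintro _ ⟨g, rfl⟩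
    obtain ⟨u, hu, h, hh, rfl⟩ := hprod g
    refine ⟨h, hh, ?_⟩
    change ρ h = ρ (u * h)
    rw [map_mul, hρ u hu, one_mul]
  · ext1 g
    simpa using hconj ρ' hρ' 1 (fun g hg ↦ by simpa using h g hg) g
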